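/- Let $\omega$ be the exponent of matrix multiplication over $\mathbb{C}$, that is, the infimum of all real $\tau$ such that $n\times n$ complex matrices can be multiplied by (non-uniform) arithmetic circuits over $\mathbb{C}$ with $O(n^{\tau})$ operations. Then for every $\varepsilon>0$ there is a constant $c_\varepsilon$ such that for every prime power $q$ the following holds for $G=\mathrm{SL}_2(\mathbb{F}_q)$. There is a complete set $\mathrm{Irr}(G)$ of pairwise non-isomorphic irreducible complex representations of $G$, and for every such set, with any choice of bases (so that each $\rho(g)$ is a $\dim\rho\times\dim\rho$ matrix), the generalized DFT $$\mathbb{C}[G]\ni\sum_{g\in G}c_g\,g\;\longmapsto\;\sum_{g\in G}c_g\bigoplus_{\rho\in\mathrm{Irr}(G)}\rho(g)$$ can be computed by an arithmetic circuit over $\mathbb{C}$ with at most $c_\varepsilon\,|G|^{\omega/2+\varepsilon}$ operations. Here an arithmetic circuit is a straight-line program of additions, subtractions and multiplications whose operands are inputs, arbitrary complex constants, or earlier results. -/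

import Mathlib

noncomputable section

namespace GenDFT

/-! ### Arithmetic circuits over `ℂ`, as straight-line programs -/

/-- An operand of an instruction: an input variable, an arbitrary complex constant, or the value
computed by the `k`-th instruction of the program (counting from `0`). -/
inductive Operand (ι : Type*) where
  | var (i : ι)
  | const (z : ℂ)
  | wire (k : ℕ)

/-- The value of an operand, given the input `x` and the list `vals` of the values computed so
far. A wire pointing to an instruction that has not been executed reads the constant `0`. -/
def Operand.eval {ι : Type*} (x : ι → ℂ) (vals : List ℂ) : Operand ι → ℂ
  | .var i => x i
  | .const z => z
  | .wire k => vals.getD k 0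

/-- A single arithmetic operation: an addition, a subtraction, or a multiplication. -/
inductive Instr (ι : Type*) where
  | add (a b : Operand ι)
  | sub (a b : Operand ι)
  | mul (a b : Operand ι)

/-- The value computed by an instruction. -/
def Instr.eval {ι : Type*} (x : ι → ℂ) (vals : List ℂ) : Instr ι → ℂ
  | .add a b => a.eval x vals + b.eval x vals
  | .sub a b => a.eval x vals - b.eval x vals
  | .mul a b => a.eval x vals * b.eval x vals

/-- An arithmetic circuit with inputs indexed by `ι` and outputs indexed by `κ`: a finite sequence
of arithmetic operations, together with the operand that is returned at each output. -/
structure Circuit (ι κ : Type*) where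
  program : List (Instr ι)
  output : κ → Operand ι

namespace Circuit

variable {ι κ : Type*}

/-- The number of arithmetic operations performed by the circuit. -/
def opCount (C : Circuit ι κ) : ℕ := C.program.length

/-- The list of the values computed by the instructions, in order, on input `x`. -/
def values (C : Circuit ι κ) (x : ι → ℂ) : List ℂ :=
  C.program.foldl (fun vals I => vals ++ [I.eval x vals]) []

/-- The map computed by the circuit. -/
def eval (C : Circuit ι κ) (x : ι → ℂ) : κ → ℂ :=
  fun k => (C.output k).eval x (C.values x)

end Circuit

/-- The map `f` can be computed by an arithmetic circuit with at most `s` operations. -/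
def ComputableWithin {ι κ : Type*} (f : (ι → ℂ) → (κ → ℂ)) (s : ℝ) : Prop :=
  ∃ C : Circuit ι κ, (C.opCount : ℝ) ≤ s ∧ ∀ x, C.eval x = f x

/-! ### The exponent of matrix multiplication -/

/-- Multiplication of two `n × n` matrices, as a map from the `2 n²` entries of the factors
(`Sum.inl` for the left one, `Sum.inr` for the right one) to the `n²` entries of the product. -/
def matMul (n : ℕ) (x : (Fin n × Fin n) ⊕ (Fin n × Fin n) → ℂ) : Fin n × Fin n → ℂ :=
  fun p => ((Matrix.of fun i j => x (.inl (i, j))) *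
    (Matrix.of fun i j => x (.inr (i, j))) : Matrix (Fin n) (Fin n) ℂ) p.1 p.2

/-- The exponent `ω` of matrix multiplication over `ℂ`: the infimum of all real `τ` such that
`n × n` matrices can be multiplied using `O(n ^ τ)` arithmetic operations. -/
def omega : ℝ :=
  sInf {τ : ℝ | ∃ b : ℝ, ∀ n : ℕ, ComputableWithin (matMul n) (b * (n : ℝ) ^ τ)}

/-! ### Complete sets of irreducible representations and the generalized DFT -/

/-- The representation of `G` on `ℂ ^ d` given by a homomorphism to `d × d` matrices. -/
def matrixRep {G : Type*} [Group G] {d : ℕ} (ρ : G →* Matrix (Fin d) (Fin d) ℂ) :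
    Representation ℂ G (Fin d → ℂ) :=
  (Matrix.toLinAlgEquiv' : Matrix (Fin d) (Fin d) ℂ ≃ₐ[ℂ] _).toAlgHom.toMonoidHom.comp ρ

/-- A complete set of irreducible representations of the finite group `G` over `ℂ`, each written
in coordinates (that is, with a choice of basis): every member is irreducible, different members
are not isomorphic, and every irreducible representation is isomorphic to a member. -/
structure IrrepSet (G : Type*) [Group G] where
  /-- the number of representations in the set -/
  num : ℕ
  /-- their dimensions -/
  dim : Fin num → ℕ
  /-- the representations -/
  rep : ∀ i, G →* Matrix (Fin (dim i)) (Fin (dim i)) ℂ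
  irreducible : ∀ i, (matrixRep (rep i)).IsIrreducible
  distinct : ∀ i j, Nonempty ((matrixRep (rep i)).Equiv (matrixRep (rep j))) → i = j
  complete : ∀ (d : ℕ) (σ : G →* Matrix (Fin d) (Fin d) ℂ), (matrixRep σ).IsIrreducible →
    ∃ i, Nonempty ((matrixRep σ).Equiv (matrixRep (rep i)))

/-- The positions `(ρ, a, b)` of the entries of the blocks of `⨁ ρ, ρ(g)`. -/
abbrev IrrepSet.Entry {G : Type*} [Group G] (R : IrrepSet G) : Type :=
  (i : Fin R.num) × (Fin (R.dim i) × Fin (R.dim i))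

/-- The generalized DFT of `G` with respect to `R`: it takes the coefficients `c` of an element of
the group algebra `ℂ[G]` to the entries of the blocks of `∑ g, c g • ⨁ ρ ∈ R, ρ(g)`. -/
def dft {G : Type*} [Group G] [Fintype G] (R : IrrepSet G) (c : G → ℂ) : R.Entry → ℂ :=
  fun e => (∑ g : G, c g • R.rep e.1 g) e.2.1 e.2.2

end GenDFT

end

/-!
Let `q` be the order of the field. Write `upper x`, `torus s`, `weyl` for the standard elements of
`SL₂`, so that the group is the disjoint union of the big cell `upper x * torus s * weyl * upper y`
and of the small cell `upper x * torus s` (`bruhat_bijective`). As the small cell times `weyl` lies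
in the big cell, it is enough to transform two functions supported on the big cell.

Fix a primitive additive character `ψ`. Every representation splits into the eigenspaces of the
unipotent subgroup for the characters `x ↦ ψ (a * x)`, and `torus s` carries the eigenspace of `a`
to that of `a * s⁻²` (`Frame`, `exists_frame`). Hence bases of the eigenspaces of three elements
`a`, one for each orbit of the squares (`exists_square_classes`), can be transported by the torus
to a basis of the whole space. If the columns refer to any basis of eigenvectors and the rows to
such a transported one, then the block `(a, b)` of the transform of a function `A x s y` on the big
cell is, in every representation, a sum over `s` of the numbers `Â (a, t a * s, b)`, where `Â` is
the Fourier transform in `x` and `y`, against a kernel that depends on `a` only through its orbit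
representative (`Frame.block_eq_sum`). So for each representative and each `b`, all blocks of all
representations are found by one matrix product. Its inner dimension is `q - 1`, the number of its
rows is `q`, and the number of its columns is at most `2 (q - 1)`, because these columns are
linearly independent functions determined by their values on the double cosets of the unipotent
subgroup (`sum_mult_mul_mult_le`); the independence is Schur orthogonality.

Altogether there are `O(q)` products of matrices of size `O(q)`, the Fourier transforms in `x` and
`y` included, and `O(1)` products of the size of each representation, for the changes of bases. An
exponent `τ` of matrix multiplication is at least `2` (`two_le_of_computableWithin`), since the
`n ^ 2` entries of a product each take an operation. Therefore `q * q ^ τ` is at most a constant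
times `|G| ^ (τ / 2)`, by `q ^ 3 ≤ 2 |G|`, and the sum of the `dim ρ ^ τ` is at most
`|G| ^ (τ / 2)`, by `∑ (dim ρ) ^ 2 ≤ |G|`. As the bases used are found by any means, the circuits
being non-uniform, the given bases of the representations play no role.

Circuits are handled through `Cost A B s`, a statement on sets of functions of the input, which
makes sequential and parallel composition immediate.
-/

noncomputable section

namespace GenDFT

/-! ### Cost of computing a set of functions from another -/

/-- `Derives A B n`: starting from the functions in `A` and the constant functions on the input
space `X`, a straight-line computation of `n` operations makes exactly the functions in `B`
available. -/
inductive Derives {X : Type*} (A : Set (X → ℂ)) : Set (X → ℂ) → ℕ → Prop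
  | refl : Derives A (A ∪ Set.range (Function.const X)) 0
  | add {B : Set (X → ℂ)} {n : ℕ} {f g : X → ℂ} (h : Derives A B n) (hf : f ∈ B) (hg : g ∈ B) :
      Derives A (insert (f + g) B) (n + 1)
  | sub {B : Set (X → ℂ)} {n : ℕ} {f g : X → ℂ} (h : Derives A B n) (hf : f ∈ B) (hg : g ∈ B) :
      Derives A (insert (f - g) B) (n + 1)
  | mul {B : Set (X → ℂ)} {n : ℕ} {f g : X → ℂ} (h : Derives A B n) (hf : f ∈ B) (hg : g ∈ B) :
      Derives A (insert (f * g) B) (n + 1)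

namespace Derives

variable {X : Type*} {A B C : Set (X → ℂ)} {m n : ℕ}

theorem base_subset (h : Derives A B n) : A ∪ Set.range (Function.const X) ⊆ B := by
  induction h with
  | refl => exact subset_rfl
  | add h hf hg ih => exact ih.trans (Set.subset_insert _ _)
  | sub h hf hg ih => exact ih.trans (Set.subset_insert _ _)
  | mul h hf hg ih => exact ih.trans (Set.subset_insert _ _)

theorem trans (h : Derives A B n) (h' : Derives B C m) : Derives A C (n + m) := by
  induction h' with
  | refl =>
    rwa [Set.union_eq_self_of_subset_right (Set.subset_union_right.trans h.base_subset)]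
  | add _ hf hg ih => exact ih.add hf hg
  | sub _ hf hg ih => exact ih.sub hf hg
  | mul _ hf hg ih => exact ih.mul hf hg

theorem union (h : Derives A B n) (S : Set (X → ℂ)) : Derives (S ∪ A) (S ∪ B) n := by
  induction h with
  | refl => rw [← Set.union_assoc]; exact .refl
  | add _ hf hg ih => rw [Set.union_insert]; exact ih.add (.inr hf) (.inr hg)
  | sub _ hf hg ih => rw [Set.union_insert]; exact ih.sub (.inr hf) (.inr hg)
  | mul _ hf hg ih => rw [Set.union_insert]; exact ih.mul (.inr hf) (.inr hg)

end Derives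

/-- `Cost A B s`: every function in `B` can be obtained, by one straight-line computation with at
most `s` operations in total, from the functions in `A` and constants. -/
def Cost {X : Type*} (A B : Set (X → ℂ)) (s : ℝ) : Prop :=
  ∃ (L : Set (X → ℂ)) (n : ℕ), Derives A L n ∧ (n : ℝ) ≤ s ∧ B ⊆ L

namespace Cost

variable {X : Type*} {A A' B B' C : Set (X → ℂ)} {s s' t : ℝ}

theorem of_subset (h : B ⊆ A) : Cost A B 0 :=
  ⟨_, 0, .refl, by simp, h.trans Set.subset_union_left⟩

theorem of_subset_const (h : B ⊆ A ∪ Set.range (Function.const X)) : Cost A B 0 :=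
  ⟨_, 0, .refl, by simp, h⟩

theorem mono (h : Cost A B s) (hA : A ⊆ A') (hB : B' ⊆ B) (hs : s ≤ s') : Cost A' B' s' := by
  obtain ⟨L, n, hL, hn, hBL⟩ := h
  refine ⟨A' ∪ L, n, ?_, hn.trans hs, hB.trans (hBL.trans Set.subset_union_right)⟩
  simpa [Set.union_eq_self_of_subset_right hA] using hL.union A'

theorem mono_target (h : Cost A B s) (hB : B' ⊆ B) : Cost A B' s := h.mono subset_rfl hB le_rfl

theorem mono_le (h : Cost A B s) (hs : s ≤ s') : Cost A B s' := h.mono subset_rfl subset_rfl hs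

theorem trans (h : Cost A B s) (h' : Cost B C t) : Cost A C (s + t) := by
  obtain ⟨L, n, hL, hn, hBL⟩ := h
  obtain ⟨M, m, hM, hm, hCM⟩ := h'
  refine ⟨L ∪ M, n + m, hL.trans ?_, by push_cast; linarith, hCM.trans Set.subset_union_right⟩
  simpa [Set.union_eq_self_of_subset_right hBL] using hM.union L

theorem union (h : Cost A B s) (h' : Cost A C t) : Cost A (B ∪ C) (s + t) := by
  obtain ⟨L, n, hL, hn, hBL⟩ := h
  obtain ⟨M, m, hM, hm, hCM⟩ := h'
  refine ⟨L ∪ M, n + m, hL.trans ?_, by push_cast; linarith, Set.union_subset_union hBL hCM⟩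
  have := hM.union L
  rwa [Set.union_eq_self_of_subset_right
    (Set.subset_union_left.trans hL.base_subset)] at this

theorem biUnion {ι : Type*} (S : Finset ι) {B : ι → Set (X → ℂ)} {s : ι → ℝ}
    (h : ∀ i ∈ S, Cost A (B i) (s i)) : Cost A (⋃ i ∈ S, B i) (∑ i ∈ S, s i) := by
  classical
  induction S using Finset.induction_on with
  | empty => simpa using of_subset (Set.empty_subset A)
  | insert a S ha ih =>
    rw [Finset.sum_insert ha, Finset.set_biUnion_insert]
    exact (h a (by simp)).union (ih fun i hi => h i (by simp [hi]))

theorem iUnion {ι : Type*} [Fintype ι] {B : ι → Set (X → ℂ)} {s : ι → ℝ}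
    (h : ∀ i, Cost A (B i) (s i)) : Cost A (⋃ i, B i) (∑ i, s i) :=
  (biUnion Finset.univ fun i _ => h i).mono_target (by simp)

/-- A family of functions, each costing at most `s`. -/
theorem range {ι : Type*} [Fintype ι] {f : ι → X → ℂ} (h : ∀ i, Cost A {f i} s) :
    Cost A (Set.range f) (Fintype.card ι * s) := by
  have := iUnion h
  simpa [Set.iUnion_singleton_eq_range] using this

theorem add {f g : X → ℂ} (hf : f ∈ A) (hg : g ∈ A) : Cost A {f + g} 1 :=
  ⟨_, 1, Derives.refl.add (.inl hf) (.inl hg), by simp, by simp⟩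

theorem mul {f g : X → ℂ} (hf : f ∈ A) (hg : g ∈ A) : Cost A {f * g} 1 :=
  ⟨_, 1, Derives.refl.mul (.inl hf) (.inl hg), by simp, by simp⟩

theorem sum {ι : Type*} (S : Finset ι) {f : ι → X → ℂ} (hf : ∀ i ∈ S, f i ∈ A) :
    Cost A {∑ i ∈ S, f i} S.card := by
  classical
  induction S using Finset.induction_on with
  | empty =>
    simp only [Finset.sum_empty, Finset.card_empty, Nat.cast_zero]
    exact of_subset_const (Set.singleton_subset_iff.2 (.inr ⟨0, rfl⟩))
  | insert a S ha ih =>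
    rw [Finset.sum_insert ha, Finset.card_insert_of_notMem ha]
    push_cast
    have h1 : Cost A {f a, ∑ i ∈ S, f i} S.card := by
      have := (of_subset (Set.singleton_subset_iff.2 (hf a (by simp)))).union
        (ih fun i hi => hf i (by simp [hi]))
      rwa [zero_add, Set.singleton_union] at this
    exact h1.trans (add (by simp) (by simp))

end Cost

/-! ### Circuits and costs -/

variable {ι κ : Type*}

/-- The values computed by a program. -/
def progValues (l : List (Instr ι)) (x : ι → ℂ) : List ℂ :=
  l.foldl (fun vals I => vals ++ [I.eval x vals]) []

theorem progValues_append (l : List (Instr ι)) (I : Instr ι) (x : ι → ℂ) :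
    progValues (l ++ [I]) x = progValues l x ++ [I.eval x (progValues l x)] := by
  simp [progValues]

theorem length_progValues (l : List (Instr ι)) (x : ι → ℂ) :
    (progValues l x).length = l.length := by
  induction l using List.reverseRecOn with
  | nil => rfl
  | append_singleton l I ih => simp [progValues_append, ih]

/-- Executing a circuit on functions that are already available. -/
theorem ComputableWithin.cost {X : Type*} {A : Set (X → ℂ)} {g : (ι → ℂ) → κ → ℂ} {s : ℝ}
    (hg : ComputableWithin g s) {F : ι → X → ℂ}
    (hF : ∀ i, F i ∈ A ∪ Set.range (Function.const X)) :
    Cost A (Set.range fun k x => g (fun i => F i x) k) s := by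
  obtain ⟨C, hC, hg⟩ := hg
  have operand_mem : ∀ (l : List (Instr ι)) (L : Set (X → ℂ)) (n : ℕ), Derives A L n →
      (∀ k, (fun x => (progValues l fun i => F i x).getD k 0) ∈ L) →
      ∀ o : Operand ι,
        (fun x => o.eval (fun i => F i x) (progValues l fun i => F i x)) ∈ L := by
    intro l L n hL hl o
    cases o with
    | var i => exact hL.base_subset (hF i)
    | const z => exact hL.base_subset (.inr ⟨z, rfl⟩)
    | wire k => exact hl k
  have key : ∀ l : List (Instr ι), ∃ L : Set (X → ℂ), Derives A L l.length ∧
      ∀ k, (fun x => (progValues l fun i => F i x).getD k 0) ∈ L := by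
    intro l
    induction l using List.reverseRecOn with
    | nil => exact ⟨_, .refl, fun k => .inr ⟨0, by funext x; simp [progValues]⟩⟩
    | append_singleton l I ih =>
      obtain ⟨L, hL, hl⟩ := ih
      have step : ∃ L', Derives A L' (l ++ [I]).length ∧ L ⊆ L' ∧
          (fun x => I.eval (fun i => F i x) (progValues l fun i => F i x)) ∈ L' := by
        rw [List.length_append, List.length_singleton]
        cases I with
        | add a b =>
          exact ⟨_, hL.add (operand_mem l L _ hL hl a) (operand_mem l L _ hL hl b),
            Set.subset_insert _ _, .inl rfl⟩
        | sub a b =>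
          exact ⟨_, hL.sub (operand_mem l L _ hL hl a) (operand_mem l L _ hL hl b),
            Set.subset_insert _ _, .inl rfl⟩
        | mul a b =>
          exact ⟨_, hL.mul (operand_mem l L _ hL hl a) (operand_mem l L _ hL hl b),
            Set.subset_insert _ _, .inl rfl⟩
      obtain ⟨L', hL', hLL', hI⟩ := step
      refine ⟨L', hL', fun k => ?_⟩
      simp only [progValues_append]
      rcases lt_trichotomy k l.length with hk | rfl | hk
      · convert hLL' (hl k) using 2 with x
        exact List.getD_append _ _ _ _ (by simpa [length_progValues] using hk)
      · convert hI using 2 with x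
        rw [List.getD_append_right _ _ _ _ (by simp [length_progValues])]
        simp [length_progValues]
      · convert hL'.base_subset (.inr ⟨0, rfl⟩) using 2 with x
        rw [List.getD_eq_default _ _ (by simp [length_progValues]; omega)]
        rfl
  obtain ⟨L, hL, hl⟩ := key C.program
  refine ⟨L, _, hL, hC, ?_⟩
  rintro _ ⟨k, rfl⟩
  convert operand_mem _ L _ hL hl (C.output k) using 2 with x
  exact (congrFun (hg fun i => F i x) k).symm

/-- An operand that does not read beyond the first `n` instructions. -/
def Operand.Bounded (n : ℕ) : Operand ι → Prop
  | .wire k => k < n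
  | _ => True

theorem Operand.Bounded.eval_append {n : ℕ} {o : Operand ι} (ho : o.Bounded n) (x : ι → ℂ)
    {vals : List ℂ} (hv : vals.length = n) (z : ℂ) : o.eval x (vals ++ [z]) = o.eval x vals := by
  cases o with
  | wire k => exact List.getD_append _ _ _ _ (hv.symm ▸ ho)
  | _ => rfl

theorem Operand.Bounded.succ {n : ℕ} {o : Operand ι} (ho : o.Bounded n) : o.Bounded (n + 1) := by
  cases o with
  | wire k => exact Nat.lt_succ_of_lt ho
  | _ => trivial

/-- A computation starting from the input variables is carried out by a circuit. -/
theorem Cost.computableWithin {f : (ι → ℂ) → κ → ℂ} {s : ℝ}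
    (h : Cost (Set.range fun (i : ι) (x : ι → ℂ) => x i) (Set.range fun k x => f x k) s) :
    ComputableWithin f s := by
  obtain ⟨L, n, hL, hn, hfL⟩ := h
  have key : ∃ l : List (Instr ι), l.length = n ∧
      ∀ g ∈ L, ∃ o : Operand ι, o.Bounded n ∧ ∀ x, g x = o.eval x (progValues l x) := by
    clear hn hfL
    have step : ∀ (l : List (Instr ι)) (I : Instr ι) (B : Set ((ι → ℂ) → ℂ)) (n : ℕ)
        (g : (ι → ℂ) → ℂ), l.length = n →
        (∀ g ∈ B, ∃ o : Operand ι, o.Bounded n ∧ ∀ x, g x = o.eval x (progValues l x)) →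
        (∀ x, g x = I.eval x (progValues l x)) →
        ∃ l : List (Instr ι), l.length = n + 1 ∧ ∀ f ∈ insert g B, ∃ o : Operand ι,
          o.Bounded (n + 1) ∧ ∀ x, f x = o.eval x (progValues l x) := by
      intro l I B n g hl hB hg
      refine ⟨l ++ [I], by simp [hl], ?_⟩
      rintro f (hf | hf)
      · rw [hf]
        refine ⟨.wire n, Nat.lt_succ_self n, fun x => ?_⟩
        rw [hg, progValues_append]
        simp [Operand.eval, ← hl, ← length_progValues l x]
      · obtain ⟨o, ho, hfo⟩ := hB f hf
        refine ⟨o, ho.succ, fun x => ?_⟩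
        rw [progValues_append, ho.eval_append x (by rw [length_progValues, hl]), hfo]
    induction hL with
    | refl =>
      refine ⟨[], rfl, ?_⟩
      rintro g (⟨i, rfl⟩ | ⟨z, rfl⟩)
      · exact ⟨.var i, trivial, fun x => rfl⟩
      · exact ⟨.const z, trivial, fun x => rfl⟩
    | add _ hf hg ih =>
      obtain ⟨l, hl, hB⟩ := ih
      obtain ⟨a, -, ha⟩ := hB _ hf
      obtain ⟨b, -, hb⟩ := hB _ hg
      exact step l (.add a b) _ _ (_ + _) hl hB fun x =>
        congrArg₂ (· + ·) (ha x) (hb x)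
    | sub _ hf hg ih =>
      obtain ⟨l, hl, hB⟩ := ih
      obtain ⟨a, -, ha⟩ := hB _ hf
      obtain ⟨b, -, hb⟩ := hB _ hg
      exact step l (.sub a b) _ _ (_ - _) hl hB fun x =>
        congrArg₂ (· - ·) (ha x) (hb x)
    | mul _ hf hg ih =>
      obtain ⟨l, hl, hB⟩ := ih
      obtain ⟨a, -, ha⟩ := hB _ hf
      obtain ⟨b, -, hb⟩ := hB _ hg
      exact step l (.mul a b) _ _ (_ * _) hl hB fun x =>
        congrArg₂ (· * ·) (ha x) (hb x)
  obtain ⟨l, hl, hB⟩ := key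
  choose o _ ho' using fun k => hB _ (hfL ⟨k, rfl⟩)
  exact ⟨⟨l, o⟩, by simpa [Circuit.opCount, hl] using hn,
    fun x => funext fun k => (ho' k x).symm⟩

/-! ### Matrix multiplication -/

/-- Multiplying an `I × J` by a `J × K` matrix of available functions, by padding both with zeros
to size `n × n`. -/
theorem Cost.matMul {X I J K : Type*} [Fintype I] [Fintype J] [Fintype K] {n : ℕ} {s : ℝ}
    (hn : ComputableWithin (matMul n) s) (hI : Fintype.card I ≤ n) (hJ : Fintype.card J ≤ n)
    (hK : Fintype.card K ≤ n) {A : Set (X → ℂ)} (M : I → J → X → ℂ) (N : J → K → X → ℂ)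
    (hM : ∀ i j, M i j ∈ A ∪ Set.range (Function.const X))
    (hN : ∀ j k, N j k ∈ A ∪ Set.range (Function.const X)) :
    Cost A (Set.range fun (p : I × K) x => ∑ j, M p.1 j x * N j p.2 x) s := by
  classical
  obtain ⟨eI⟩ : Nonempty (I ↪ Fin n) := Function.Embedding.nonempty_of_card_le (by simpa using hI)
  obtain ⟨eJ⟩ : Nonempty (J ↪ Fin n) := Function.Embedding.nonempty_of_card_le (by simpa using hJ)
  obtain ⟨eK⟩ : Nonempty (K ↪ Fin n) := Function.Embedding.nonempty_of_card_le (by simpa using hK)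
  let F : (Fin n × Fin n) ⊕ (Fin n × Fin n) → X → ℂ := fun p => match p with
    | .inl (a, b) => if h : ∃ p : I × J, eI p.1 = a ∧ eJ p.2 = b then M h.choose.1 h.choose.2 else 0
    | .inr (a, b) => if h : ∃ p : J × K, eJ p.1 = a ∧ eK p.2 = b then N h.choose.1 h.choose.2 else 0
  have hF : ∀ p, F p ∈ A ∪ Set.range (Function.const X) := by
    rintro (⟨a, b⟩ | ⟨a, b⟩)
    · by_cases h : ∃ p : I × J, eI p.1 = a ∧ eJ p.2 = b
      · simpa only [F, dif_pos h] using hM _ _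
      · simp only [F, dif_neg h]; exact .inr ⟨0, rfl⟩
    · by_cases h : ∃ p : J × K, eJ p.1 = a ∧ eK p.2 = b
      · simpa only [F, dif_pos h] using hN _ _
      · simp only [F, dif_neg h]; exact .inr ⟨0, rfl⟩
  have hl : ∀ i j, F (.inl (eI i, eJ j)) = M i j := by
    intro i j
    have h : ∃ p : I × J, eI p.1 = eI i ∧ eJ p.2 = eJ j := ⟨(i, j), rfl, rfl⟩
    simp only [F, dif_pos h]
    rw [eI.injective h.choose_spec.1, eJ.injective h.choose_spec.2]
  have hr : ∀ i j, F (.inr (eJ i, eK j)) = N i j := by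
    intro i j
    have h : ∃ p : J × K, eJ p.1 = eJ i ∧ eK p.2 = eK j := ⟨(i, j), rfl, rfl⟩
    simp only [F, dif_pos h]
    rw [eJ.injective h.choose_spec.1, eK.injective h.choose_spec.2]
  have h0 : ∀ a b, (∀ j, eJ j ≠ b) → F (.inl (a, b)) = 0 := by
    intro a b hb
    have h : ¬ ∃ p : I × J, eI p.1 = a ∧ eJ p.2 = b := fun ⟨p, _, hp⟩ => hb _ hp
    simp only [F, dif_neg h]
  refine (hn.cost hF).mono_target ?_
  rintro _ ⟨⟨i, k⟩, rfl⟩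
  refine ⟨(eI i, eK k), funext fun x => ?_⟩
  simp only [GenDFT.matMul, Matrix.mul_apply, Matrix.of_apply]
  rw [← Finset.sum_subset (Finset.subset_univ (Finset.univ.map eJ)), Finset.sum_map]
  · simp [hl, hr]
  · intro b _ hb
    rw [h0 _ b fun j hj => hb (by simp [← hj])]
    simp

/-- The schoolbook algorithm. -/
theorem computableWithin_matMul_cube (n : ℕ) :
    ComputableWithin (matMul n) (2 * (n : ℝ) ^ (3 : ℝ)) := by
  apply Cost.computableWithin
  set A : Set (((Fin n × Fin n) ⊕ (Fin n × Fin n) → ℂ) → ℂ) :=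
    Set.range fun (i : (Fin n × Fin n) ⊕ (Fin n × Fin n)) x => x i
  have h1 : Cost A (Set.range fun (p : Fin n × Fin n × Fin n) =>
      (fun (x : (Fin n × Fin n) ⊕ (Fin n × Fin n) → ℂ) => x (.inl (p.1, p.2.1))) *
        fun x => x (.inr (p.2.1, p.2.2)))
      (Fintype.card (Fin n × Fin n × Fin n) * 1) :=
    Cost.range fun p => Cost.mul ⟨_, rfl⟩ ⟨_, rfl⟩
  have h2 := Cost.range (f := fun (p : Fin n × Fin n) => ∑ j,
      (fun (x : (Fin n × Fin n) ⊕ (Fin n × Fin n) → ℂ) => x (.inl (p.1, j))) *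
        fun x => x (.inr (j, p.2))) fun p => Cost.sum Finset.univ
    (A := Set.range fun (p : Fin n × Fin n × Fin n) =>
      (fun (x : (Fin n × Fin n) ⊕ (Fin n × Fin n) → ℂ) => x (.inl (p.1, p.2.1))) *
        fun x => x (.inr (p.2.1, p.2.2))) fun j _ => ⟨(p.1, j, p.2), rfl⟩
  refine (h1.trans h2).mono subset_rfl ?_ ?_
  · rintro _ ⟨p, rfl⟩
    refine ⟨p, ?_⟩
    funext x
    simp [GenDFT.matMul, Matrix.mul_apply]
  · simp only [Fintype.card_prod, Fintype.card_fin, Finset.card_univ]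
    rw [show (3 : ℝ) = (3 : ℕ) by norm_num, Real.rpow_natCast]
    push_cast
    nlinarith

/-- The `n²` entries of a matrix product are distinct functions, none of them affine in the
input, so that each takes an operation of its own. -/
theorem sq_le_of_computableWithin {n : ℕ} {s : ℝ} (h : ComputableWithin (matMul n) s) :
    (n : ℝ) ^ 2 ≤ s := by
  obtain ⟨C, hC, h⟩ := h
  -- a pair of rank-one factors whose product is supported at the entry `p`, with value `z ^ 2 * n`
  let X : Fin n × Fin n → ℂ → (Fin n × Fin n) ⊕ (Fin n × Fin n) → ℂ := fun p z e => match e with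
    | .inl (i, _) => if i = p.1 then z else 0
    | .inr (_, j) => if j = p.2 then z else 0
  have hX : ∀ p z p', C.eval (X p z) p' = if p' = p then n * z ^ 2 else 0 := by
    intro p z p'
    rw [h]
    simp only [matMul, Matrix.mul_apply, Matrix.of_apply, X]
    by_cases h1 : p'.1 = p.1 <;> by_cases h2 : p'.2 = p.2 <;>
      simp [h1, h2, Prod.ext_iff, sq]
  have hwire : ∀ p, ∃ k : Fin C.program.length, C.output p = .wire k := by
    intro p
    have hn : (n : ℂ) ≠ 0 := by
      have := p.1.pos
      exact_mod_cast this.ne'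
    have h0 := hX p 0 p
    have h1 := hX p 1 p
    have h2 := hX p 2 p
    simp only [Circuit.eval, if_true] at h0 h1 h2
    cases hp : C.output p with
    | var e =>
      exfalso
      rw [hp] at h1 h2
      have : X p 2 e = 2 * X p 1 e := by
        rcases e with ⟨i, j⟩ | ⟨i, j⟩ <;> simp only [X] <;> split_ifs <;> norm_num
      simp only [Operand.eval] at h1 h2
      rw [this, h1] at h2
      apply hn
      linear_combination (-1 / 2 : ℂ) * h2
    | const z =>
      exfalso
      rw [hp] at h0 h1
      simp only [Operand.eval] at h0 h1
      rw [h0] at h1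
      apply hn
      linear_combination -h1
    | wire k =>
      by_cases hk : k < C.program.length
      · exact ⟨⟨k, hk⟩, rfl⟩
      · exfalso
        rw [hp] at h1
        simp only [Operand.eval] at h1
        rw [List.getD_eq_default _ _ (show (C.values (X p 1)).length ≤ k from
          (length_progValues C.program (X p 1)).le.trans (not_lt.1 hk))] at h1
        apply hn
        linear_combination -h1
  choose k hk using hwire
  have hinj : Function.Injective k := by
    intro p p' hpp
    by_contra hne
    have h1 := hX p 1 p
    have h2 := hX p 1 p'
    simp only [Circuit.eval, hk, hpp, if_true, if_neg (Ne.symm hne)] at h1 h2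
    have hn : (n : ℂ) ≠ 0 := by
      have := p.1.pos
      exact_mod_cast this.ne'
    apply hn
    linear_combination h2 - h1
  have := Fintype.card_le_of_injective k hinj
  simp only [Fintype.card_prod, Fintype.card_fin] at this
  refine le_trans ?_ hC
  rw [sq]
  exact_mod_cast this

theorem two_le_of_computableWithin {τ b : ℝ}
    (h : ∀ n : ℕ, ComputableWithin (matMul n) (b * (n : ℝ) ^ τ)) : 2 ≤ τ := by
  by_contra! hτ
  have hb : ∀ n : ℕ, 1 ≤ n → (n : ℝ) ^ (2 - τ) ≤ b := by
    intro n hn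
    have hn' : (0 : ℝ) < n := by exact_mod_cast hn
    have := sq_le_of_computableWithin (h n)
    rw [Real.rpow_sub hn', div_le_iff₀ (Real.rpow_pos_of_pos hn' τ)]
    exact_mod_cast this
  have ht := (tendsto_rpow_atTop (show 0 < 2 - τ by linarith)).comp
    (tendsto_natCast_atTop_atTop (R := ℝ))
  obtain ⟨n, hn1, hn2⟩ := ((ht.eventually_gt_atTop b).and
    (Filter.eventually_ge_atTop 1)).exists
  exact absurd (hb n hn2) (not_le.2 hn1)

/-- The infimum defining `omega` is over a nonempty set that is bounded below by `2`, so there are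
exponents arbitrarily close to it. -/
theorem exists_exponent {δ : ℝ} (hδ : 0 < δ) : ∃ τ b : ℝ, 2 ≤ τ ∧ τ < omega + δ ∧ 0 ≤ b ∧
    ∀ n : ℕ, ComputableWithin (matMul n) (b * (n : ℝ) ^ τ) := by
  obtain ⟨τ, ⟨b, hb⟩, hτ⟩ := exists_lt_of_csInf_lt
    (s := {τ : ℝ | ∃ b : ℝ, ∀ n : ℕ, ComputableWithin (matMul n) (b * (n : ℝ) ^ τ)})
    ⟨3, 2, computableWithin_matMul_cube⟩ (show omega < omega + δ by linarith)
  refine ⟨τ, b, two_le_of_computableWithin hb, hτ, ?_, hb⟩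
  have := sq_le_of_computableWithin (hb 1)
  simp at this
  linarith


/-! ### Orthogonality of matrix coefficients -/

section Orthogonality

variable {G : Type*} [Group G]

/-- A matrix `M` with `ρ g * M = M * σ g` for all `g`, as a map of representations from `σ` to `ρ`. -/
def intertwiner {d e : ℕ} (ρ : G →* Matrix (Fin d) (Fin d) ℂ) (σ : G →* Matrix (Fin e) (Fin e) ℂ)
    (M : Matrix (Fin d) (Fin e) ℂ) (h : ∀ g, ρ g * M = M * σ g) :
    Representation.IntertwiningMap (matrixRep σ) (matrixRep ρ) where
  toLinearMap := Matrix.toLin' M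
  isIntertwining' g := by
    refine LinearMap.ext fun v => ?_
    change M.mulVec ((σ g).mulVec v) = (ρ g).mulVec (M.mulVec v)
    rw [Matrix.mulVec_mulVec, Matrix.mulVec_mulVec, h]

theorem intertwiner_eq_zero {d e : ℕ} {ρ : G →* Matrix (Fin d) (Fin d) ℂ}
    {σ : G →* Matrix (Fin e) (Fin e) ℂ} (hρ : (matrixRep ρ).IsIrreducible)
    (hσ : (matrixRep σ).IsIrreducible) (hne : ¬ Nonempty ((matrixRep σ).Equiv (matrixRep ρ)))
    {M : Matrix (Fin d) (Fin e) ℂ} (h : ∀ g, ρ g * M = M * σ g) : M = 0 := by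
  have := not_nonempty_iff.1 hne
  have h0 : intertwiner ρ σ M h = 0 := Subsingleton.elim _ _
  have := congrArg (fun f => f.toLinearMap) h0
  exact Matrix.toLin'.injective (this.trans (map_zero _).symm)

theorem intertwiner_eq_smul_one {d : ℕ} {ρ : G →* Matrix (Fin d) (Fin d) ℂ}
    (hρ : (matrixRep ρ).IsIrreducible) {M : Matrix (Fin d) (Fin d) ℂ}
    (h : ∀ g, ρ g * M = M * ρ g) : ∃ c : ℂ, M = c • 1 := by
  obtain ⟨c, hc⟩ := (Representation.IsIrreducible.algebraMap_intertwiningMap_bijective_of_isAlgClosed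
    (ρ := matrixRep ρ)).2 (intertwiner ρ ρ M h)
  refine ⟨c, Matrix.toLin'.injective ?_⟩
  have := congrArg (fun f => f.toLinearMap) hc
  refine this.symm.trans ?_
  rw [map_smul, Matrix.toLin'_one]
  rfl

variable [Fintype G]

/-- Averaging a matrix over the group gives an intertwiner. -/
theorem average_intertwines {d e : ℕ} (ρ : G →* Matrix (Fin d) (Fin d) ℂ)
    (σ : G →* Matrix (Fin e) (Fin e) ℂ) (B : Matrix (Fin d) (Fin e) ℂ) (h : G) :
    ρ h * (∑ g, ρ g * B * σ g⁻¹) = (∑ g, ρ g * B * σ g⁻¹) * σ h := by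
  rw [Matrix.mul_sum, Matrix.sum_mul]
  refine Fintype.sum_equiv (Equiv.mulLeft h) _ _ fun g => ?_
  simp only [Equiv.coe_mulLeft, mul_inv_rev, map_mul, Matrix.mul_assoc]
  rw [← map_mul σ h⁻¹ h]
  simp

theorem mul_single_mul_apply {d e : ℕ} (P : Matrix (Fin d) (Fin d) ℂ) (Q : Matrix (Fin e) (Fin e) ℂ)
    (a k : Fin d) (l b : Fin e) : (P * Matrix.single k l (1 : ℂ) * Q) a b = P a k * Q l b := by
  rw [Matrix.mul_apply, Finset.sum_eq_single l]
  · simp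
  · intro j _ hj
    rw [Matrix.mul_single_apply_of_ne _ _ _ _ _ hj]
    simp
  · simp

theorem sum_coeff_mul_coeff_eq_zero {d e : ℕ} {ρ : G →* Matrix (Fin d) (Fin d) ℂ}
    {σ : G →* Matrix (Fin e) (Fin e) ℂ} (hρ : (matrixRep ρ).IsIrreducible)
    (hσ : (matrixRep σ).IsIrreducible) (hne : ¬ Nonempty ((matrixRep σ).Equiv (matrixRep ρ)))
    (a k : Fin d) (l b : Fin e) : ∑ g, ρ g a k * σ g⁻¹ l b = 0 := by
  have := congrFun (congrFun (intertwiner_eq_zero hρ hσ hne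
    (average_intertwines ρ σ (Matrix.single k l 1))) a) b
  simpa [Matrix.sum_apply, mul_single_mul_apply] using this

/-- Schur orthogonality for the coefficients of one irreducible representation. -/
theorem sum_coeff_mul_coeff {d : ℕ} {ρ : G →* Matrix (Fin d) (Fin d) ℂ}
    (hρ : (matrixRep ρ).IsIrreducible) (a k l b : Fin d) :
    ∑ g, ρ g a k * ρ g⁻¹ l b =
      if a = b then if k = l then (Fintype.card G : ℂ) / d else 0 else 0 := by
  obtain ⟨c, hc⟩ := intertwiner_eq_smul_one hρ (average_intertwines ρ ρ (Matrix.single k l 1))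
  have hd : (d : ℂ) ≠ 0 := by
    have := a.pos
    exact_mod_cast this.ne'
  have htr : c * d = if k = l then (Fintype.card G : ℂ) else 0 := by
    have := congrArg Matrix.trace hc
    rw [Matrix.trace_sum, Matrix.trace_smul, Matrix.trace_one, Fintype.card_fin, smul_eq_mul] at this
    rw [← this]
    have h1 : ∀ g : G, (ρ g * Matrix.single k l 1 * ρ g⁻¹).trace = if k = l then (1 : ℂ) else 0 := by
      intro g
      rw [Matrix.mul_assoc, Matrix.trace_mul_comm, Matrix.mul_assoc, ← map_mul]
      simp only [inv_mul_cancel, map_one, mul_one]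
      split_ifs with h
      · rw [h, Matrix.trace_single_eq_same]
      · rw [Matrix.trace_single_eq_of_ne _ _ _ h]
    simp [h1]
  have := congrFun (congrFun hc a) b
  simp only [Matrix.sum_apply, mul_single_mul_apply, Matrix.smul_apply, Matrix.one_apply,
    smul_eq_mul] at this
  rw [this]
  have hc' : c = if k = l then (Fintype.card G : ℂ) / d else 0 := by
    rw [eq_div_of_mul_eq hd htr]
    split_ifs <;> simp
  rw [← hc']
  split_ifs <;> simp

variable {ι : Type*} {d : ι → ℕ} {ρ : ∀ i, G →* Matrix (Fin (d i)) (Fin (d i)) ℂ}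

/-- The coefficients of pairwise non-isomorphic irreducible representations are linearly
independent functions on the group. -/
theorem eq_zero_of_sum_trace_eq_zero (hirr : ∀ i, (matrixRep (ρ i)).IsIrreducible)
    (hdist : ∀ i j, Nonempty ((matrixRep (ρ i)).Equiv (matrixRep (ρ j))) → i = j)
    (s : Finset ι) (Y : ∀ i, Matrix (Fin (d i)) (Fin (d i)) ℂ)
    (hY : ∀ g, ∑ i ∈ s, (Y i * ρ i g).trace = 0) : ∀ i ∈ s, Y i = 0 := by
  intro j hj
  ext l b
  have h1 : ∑ g, (∑ i ∈ s, (Y i * ρ i g).trace) * ρ j g⁻¹ l b = 0 := by simp [hY]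
  have h2 : ∀ i ∈ s, i ≠ j → ∑ g, (Y i * ρ i g).trace * ρ j g⁻¹ l b = 0 := by
    intro i _ hij
    simp only [Matrix.trace, Matrix.diag_apply, Matrix.mul_apply, Finset.sum_mul]
    rw [Finset.sum_comm]
    refine Finset.sum_eq_zero fun k _ => ?_
    rw [Finset.sum_comm]
    refine Finset.sum_eq_zero fun a _ => ?_
    simp only [mul_assoc, ← Finset.mul_sum]
    rw [sum_coeff_mul_coeff_eq_zero (hirr i) (hirr j) fun h => hij (hdist _ _ h).symm, mul_zero]
  have h3 : ∑ g, (Y j * ρ j g).trace * ρ j g⁻¹ l b = Y j l b * ((Fintype.card G : ℂ) / d j) := by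
    simp only [Matrix.trace, Matrix.diag_apply, Matrix.mul_apply, Finset.sum_mul]
    rw [Finset.sum_comm]
    have : ∀ k, ∑ g, ∑ a, Y j k a * ρ j g a k * ρ j g⁻¹ l b =
        if k = l then Y j l b * ((Fintype.card G : ℂ) / d j) else 0 := by
      intro k
      rw [Finset.sum_comm]
      simp only [mul_assoc, ← Finset.mul_sum, sum_coeff_mul_coeff (hirr j)]
      split_ifs with h
      · subst h; simp
      · simp
    simp [this]
  simp only [Finset.sum_mul] at h1
  rw [Finset.sum_comm, Finset.sum_eq_single_of_mem j hj h2, h3] at h1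
  have hd : (d j : ℂ) ≠ 0 := by
    have := l.pos
    exact_mod_cast this.ne'
  have hG : (Fintype.card G : ℂ) ≠ 0 := by exact_mod_cast Fintype.card_ne_zero
  simpa [hd, hG] using h1

theorem sum_sq_dim_le (hirr : ∀ i, (matrixRep (ρ i)).IsIrreducible)
    (hdist : ∀ i j, Nonempty ((matrixRep (ρ i)).Equiv (matrixRep (ρ j))) → i = j)
    (s : Finset ι) : ∑ i ∈ s, d i ^ 2 ≤ Fintype.card G := by
  classical
  let L : (∀ i : s, Matrix (Fin (d i)) (Fin (d i)) ℂ) →ₗ[ℂ] (G → ℂ) :=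
    { toFun := fun Y g => ∑ i, (Y i * ρ i g).trace
      map_add' := fun Y Z => by
        funext g; simp [Matrix.add_mul, Finset.sum_add_distrib]
      map_smul' := fun c Y => by
        funext g; simp [Finset.mul_sum] }
  have hL : Function.Injective L := by
    rw [← LinearMap.ker_eq_bot, LinearMap.ker_eq_bot']
    intro Y hY
    have := eq_zero_of_sum_trace_eq_zero (ρ := fun i : s => ρ i) (fun i => hirr i)
      (fun i j h => Subtype.ext (hdist _ _ h)) Finset.univ Y (fun g => congrFun hY g)
    funext i
    exact this i (Finset.mem_univ i)
  have := LinearMap.finrank_le_finrank_of_injective hL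
  rw [Module.finrank_pi_fintype] at this
  simp only [Module.finrank_matrix, Fintype.card_fin, Module.finrank_self, mul_one,
    Module.finrank_fintype_fun_eq_card] at this
  rw [Finset.sum_coe_sort s (fun i => d i * d i)] at this
  simpa [sq] using this

end Orthogonality

/-! ### Complete sets of irreducible representations exist -/

theorem pos_of_isIrreducible {G : Type*} [Group G] {d : ℕ} {ρ : G →* Matrix (Fin d) (Fin d) ℂ}
    (h : (matrixRep ρ).IsIrreducible) : 0 < d := by
  rcases Nat.eq_zero_or_pos d with rfl | hd
  · exfalso
    have := h.toNontrivial
    obtain ⟨a, b, hab⟩ := this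
    apply hab
    ext v
    rw [Subsingleton.elim v 0]
    exact iff_of_true a.toSubmodule.zero_mem b.toSubmodule.zero_mem
  · exact hd

/-- Isomorphism of irreducible matrix representations. -/
def irrepSetoid (G : Type*) [Group G] :
    Setoid {ρ : (d : ℕ) × (G →* Matrix (Fin d) (Fin d) ℂ) // (matrixRep ρ.2).IsIrreducible} where
  r ρ σ := Nonempty ((matrixRep ρ.1.2).Equiv (matrixRep σ.1.2))
  iseqv := ⟨fun _ => ⟨.refl _⟩, fun ⟨e⟩ => ⟨e.symm⟩, fun ⟨e⟩ ⟨f⟩ => ⟨e.trans f⟩⟩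

theorem nonempty_irrepSet (G : Type*) [Group G] [Fintype G] : Nonempty (IrrepSet G) := by
  classical
  let Q := Quotient (irrepSetoid G)
  have hdist : ∀ i j : Q,
      Nonempty ((matrixRep i.out.1.2).Equiv (matrixRep j.out.1.2)) → i = j := fun i j h =>
    Quotient.out_equiv_out.1 (show (irrepSetoid G).r i.out j.out from h)
  have hfin : Finite Q := by
    refine Set.finite_univ_iff.1 (Set.not_infinite.1 fun hinf => ?_)
    obtain ⟨s, -, hs⟩ := hinf.exists_subset_card_eq (Fintype.card G + 1)
    have h1 := sum_sq_dim_le (ρ := fun i : Q => i.out.1.2) (fun i => i.out.2) hdist s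
    have h2 : ∑ i ∈ s, 1 ≤ ∑ i ∈ s, i.out.1.1 ^ 2 :=
      Finset.sum_le_sum fun i _ => Nat.one_le_pow _ _ (pos_of_isIrreducible i.out.2)
    simp only [Finset.sum_const, smul_eq_mul, mul_one] at h2
    omega
  let e := (Finite.equivFin Q).symm
  exact ⟨{ num := Nat.card Q
           dim := fun i => (e i).out.1.1
           rep := fun i => (e i).out.1.2
           irreducible := fun i => (e i).out.2
           distinct := fun i j h => e.injective (hdist _ _ h)
           complete := fun d σ hσ => by
            refine ⟨e.symm (Quotient.mk _ ⟨⟨d, σ⟩, hσ⟩), ?_⟩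
            rw [e.apply_symm_apply]
            have h : (irrepSetoid G).r _ _ :=
              (irrepSetoid G).symm (Quotient.mk_out (s := irrepSetoid G) ⟨⟨d, σ⟩, hσ⟩)
            exact h }⟩


/-! ### The Bruhat decomposition of `SL₂` -/

section Bruhat

open Matrix

variable {F : Type*} [Field F]

/-- The unipotent matrix with entry `x` above the diagonal. -/
def upper (x : F) : SpecialLinearGroup (Fin 2) F :=
  ⟨!![1, x; 0, 1], by simp [Matrix.det_fin_two]⟩

/-- The diagonal matrix with entries `t` and `t⁻¹`. -/
def torus (t : Fˣ) : SpecialLinearGroup (Fin 2) F :=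
  ⟨!![(t : F), 0; 0, ((t⁻¹ : Fˣ) : F)], by simp [Matrix.det_fin_two]⟩

/-- The Weyl element. -/
def weyl (F : Type*) [Field F] : SpecialLinearGroup (Fin 2) F :=
  ⟨!![0, 1; -1, 0], by simp [Matrix.det_fin_two]⟩

theorem coe_upper (x : F) : (upper x : Matrix (Fin 2) (Fin 2) F) = !![1, x; 0, 1] := rfl

theorem coe_torus (t : Fˣ) :
    (torus t : Matrix (Fin 2) (Fin 2) F) = !![(t : F), 0; 0, (t : F)⁻¹] := by
  simp [torus]

theorem coe_weyl : (weyl F : Matrix (Fin 2) (Fin 2) F) = !![0, 1; -1, 0] := rfl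

theorem upper_add (x y : F) : upper (x + y) = upper x * upper y := by
  ext i j
  fin_cases i <;> fin_cases j <;> simp [coe_upper, Matrix.mul_apply, Fin.sum_univ_two, add_comm]

theorem upper_zero : upper (0 : F) = 1 := by
  ext i j
  fin_cases i <;> fin_cases j <;> simp [coe_upper]

theorem torus_mul (s t : Fˣ) : torus (s * t) = torus s * torus t := by
  ext i j
  fin_cases i <;> fin_cases j <;> simp [coe_torus, Matrix.mul_apply, Fin.sum_univ_two, mul_comm]

theorem torus_one : torus (1 : Fˣ) = 1 := by
  ext i j
  fin_cases i <;> fin_cases j <;> simp [coe_torus]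

theorem torus_mul_upper (t : Fˣ) (x : F) :
    torus t * upper x = upper (t ^ 2 * x) * torus t := by
  ext i j
  fin_cases i <;> fin_cases j <;>
    simp [coe_upper, coe_torus, Matrix.mul_apply, Fin.sum_univ_two]
  field_simp

/-- The parametrization of `SL₂` by its two Bruhat cells. -/
def bruhat : (F × Fˣ × F) ⊕ (F × Fˣ) → SpecialLinearGroup (Fin 2) F
  | .inl (x, t, y) => upper x * torus t * weyl F * upper y
  | .inr (x, t) => upper x * torus t

theorem coe_bruhat_inl (x : F) (t : Fˣ) (y : F) :
    (bruhat (.inl (x, t, y)) : Matrix (Fin 2) (Fin 2) F) =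
      !![-(x * (t : F)⁻¹), t - x * (t : F)⁻¹ * y; -(t : F)⁻¹, -((t : F)⁻¹ * y)] := by
  ext i j
  fin_cases i <;> fin_cases j <;>
    simp [bruhat, coe_upper, coe_torus, coe_weyl, Matrix.mul_apply, Fin.sum_univ_two]
  ring

theorem coe_bruhat_inr (x : F) (t : Fˣ) :
    (bruhat (.inr (x, t)) : Matrix (Fin 2) (Fin 2) F) = !![(t : F), x * (t : F)⁻¹; 0, (t : F)⁻¹] := by
  ext i j
  fin_cases i <;> fin_cases j <;>
    simp [bruhat, coe_upper, coe_torus, Matrix.mul_apply, Fin.sum_univ_two]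

theorem bruhat_injective : Function.Injective (bruhat (F := F)) := by
  intro p q h
  have h' := congrArg (fun g : SpecialLinearGroup (Fin 2) F => (g : Matrix (Fin 2) (Fin 2) F)) h
  have e : ∀ i j, _ := fun i j => congrFun (congrFun h' i) j
  have e00 := e 0 0
  have e01 := e 0 1
  have e10 := e 1 0
  have e11 := e 1 1
  rcases p with ⟨x, t, y⟩ | ⟨x, t⟩ <;> rcases q with ⟨x', t', y'⟩ | ⟨x', t'⟩ <;>
    simp only [coe_bruhat_inl, coe_bruhat_inr, Matrix.of_apply, Matrix.cons_val', Matrix.cons_val_zero,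
      Matrix.cons_val_one, Matrix.cons_val_fin_one] at e00 e01 e10 e11
  · have ht : t = t' := Units.ext (inv_injective (neg_injective e10))
    subst ht
    have hx : x = x' := by simpa using e00
    have hy : y = y' := by simpa using e11
    rw [hx, hy]
  · exact absurd e10 (by simp)
  · exact absurd e10 (by simp)
  · have ht : t = t' := Units.ext e00
    subst ht
    have hx : x = x' := by simpa using e01
    rw [hx]

theorem bruhat_surjective : Function.Surjective (bruhat (F := F)) := by
  intro g
  have hdet := g.2
  rw [Matrix.det_fin_two] at hdet
  by_cases hc : g 1 0 = 0
  · have hc' : (g : Matrix (Fin 2) (Fin 2) F) 1 0 = 0 := hc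
    rw [hc', mul_zero, sub_zero] at hdet
    have ha : (g : Matrix (Fin 2) (Fin 2) F) 0 0 ≠ 0 := left_ne_zero_of_mul_eq_one hdet
    refine ⟨.inr (g 0 1 * g 0 0, Units.mk0 _ ha), Subtype.ext ?_⟩
    rw [coe_bruhat_inr]
    ext i j
    fin_cases i <;> fin_cases j <;> simp [ha, hc']
    exact (eq_inv_of_mul_eq_one_right hdet).symm
  · have hc' : (g : Matrix (Fin 2) (Fin 2) F) 1 0 ≠ 0 := hc
    refine ⟨.inl (g 0 0 / g 1 0, Units.mk0 (-(g 1 0)⁻¹) (by simpa using hc'), g 1 1 / g 1 0),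
      Subtype.ext ?_⟩
    rw [coe_bruhat_inl]
    ext i j
    fin_cases i <;> fin_cases j <;> simp
    · field_simp
    · field_simp
      linear_combination hdet
    · field_simp

theorem bruhat_bijective : Function.Bijective (bruhat (F := F)) :=
  ⟨bruhat_injective, bruhat_surjective⟩

theorem card_pow_three_le [Fintype F] [DecidableEq F] :
    Fintype.card F ^ 3 ≤ 2 * Fintype.card (SpecialLinearGroup (Fin 2) F) := by
  have h := Fintype.card_congr (Equiv.ofBijective _ (bruhat_bijective (F := F)))
  simp only [Fintype.card_sum, Fintype.card_prod, Fintype.card_units] at h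
  have h2 : 1 < Fintype.card F := Fintype.one_lt_card
  obtain ⟨k, hk⟩ : ∃ k, Fintype.card F = k + 2 := ⟨_, (Nat.sub_add_cancel h2).symm⟩
  rw [← h, hk, show k + 2 - 1 = k + 1 from rfl]
  ring_nf
  nlinarith

/-- Up to nonzero squares, a finite field has at most three elements. -/
theorem exists_square_classes (F : Type*) [Field F] [Fintype F] :
    ∃ (e : Fin 3 → F) (cl : F → Fin 3) (t : F → Fˣ),
      ∀ a, a = e (cl a) * (((t a)⁻¹ ^ 2 : Fˣ) : F) := by
  classical
  have hn : ∃ n : F, ∀ a : F, a ≠ 0 → ¬ IsSquare a → ∃ t : Fˣ, a = n * ((t⁻¹ ^ 2 : Fˣ) : F) := by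
    by_cases h : ∃ n : F, n ≠ 0 ∧ ¬ IsSquare n
    · obtain ⟨n, hn0, hn⟩ := h
      refine ⟨n, fun a ha0 ha => ?_⟩
      have h1 : quadraticChar F (a * n) = 1 := by
        rw [map_mul, quadraticChar_neg_one_iff_not_isSquare.2 ha,
          quadraticChar_neg_one_iff_not_isSquare.2 hn]
        norm_num
      obtain ⟨b, hb⟩ := (quadraticChar_one_iff_isSquare (mul_ne_zero ha0 hn0)).1 h1
      have hb0 : b ≠ 0 := by
        rintro rfl
        exact mul_ne_zero ha0 hn0 (by simpa using hb)
      refine ⟨Units.mk0 (n / b) (div_ne_zero hn0 hb0), ?_⟩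
      simp only [Units.val_pow_eq_pow_val, Units.val_inv_eq_inv_val, Units.val_mk0]
      field_simp
      linear_combination hb
    · -- every element is a square, as in characteristic two
      push Not at h
      exact ⟨0, fun a ha0 ha => absurd (h a ha0) ha⟩
  obtain ⟨n, hn⟩ := hn
  have key : ∀ a : F, ∃ (i : Fin 3) (t : Fˣ), a = ![0, 1, n] i * ((t⁻¹ ^ 2 : Fˣ) : F) := by
    intro a
    by_cases ha0 : a = 0
    · exact ⟨0, 1, by simp [ha0]⟩
    by_cases ha : IsSquare a
    · obtain ⟨b, rfl⟩ := ha
      have hb : b ≠ 0 := left_ne_zero_of_mul ha0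
      refine ⟨1, (Units.mk0 b hb)⁻¹, ?_⟩
      simp [sq]
    · obtain ⟨t, ht⟩ := hn a ha0 ha
      exact ⟨2, t, by simpa using ht⟩
  choose cl t h using key
  exact ⟨_, cl, t, h⟩

end Bruhat

/-! ### Diagonalizing the unipotent subgroup -/

/-- An idempotent matrix is the product of an injection and a retraction of it. -/
theorem exists_factor_of_idempotent {d : ℕ} (P : Matrix (Fin d) (Fin d) ℂ) (hP : P * P = P) :
    ∃ (m : ℕ) (B : Matrix (Fin d) (Fin m) ℂ) (C : Matrix (Fin m) (Fin d) ℂ),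
      B * C = P ∧ C * B = 1 := by
  let V := LinearMap.range (Matrix.toLin' P)
  let e : V ≃ₗ[ℂ] (Fin (Module.finrank ℂ V) → ℂ) := (Module.finBasis ℂ V).equivFun
  refine ⟨_, LinearMap.toMatrix' (V.subtype ∘ₗ e.symm.toLinearMap),
    LinearMap.toMatrix' (e.toLinearMap ∘ₗ (Matrix.toLin' P).rangeRestrict), ?_, ?_⟩
  · rw [← LinearMap.toMatrix'_comp]
    apply Matrix.toLin'.injective
    rw [Matrix.toLin'_toMatrix']
    refine LinearMap.ext fun v => ?_
    simp
  · rw [← LinearMap.toMatrix'_comp, ← LinearMap.toMatrix'_id]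
    congr 1
    refine LinearMap.ext fun v => ?_
    simp only [LinearMap.comp_apply, LinearEquiv.coe_coe, LinearMap.id_apply]
    apply e.symm.injective
    rw [e.symm_apply_apply]
    obtain ⟨y, hy⟩ := (e.symm v).2
    apply Subtype.ext
    rw [LinearMap.rangeRestrict, LinearMap.codRestrict_apply, Submodule.subtype_apply, ← hy]
    simp [Matrix.mulVec_mulVec, hP]

section Frame

open Matrix

variable {F : Type*} [Field F] {d : ℕ}

/-- A decomposition of a representation of `SL₂(F)` into the eigenspaces of the unipotent
subgroup. The eigenspace of the character `x ↦ ψ (a * x)` has dimension `mult a`; the columns of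
`inc a` are a basis of it, and `coord a` gives the coordinates, with respect to this basis, of the
projection to it. The last field says that the torus permutes the eigenspaces. -/
structure Frame (ψ : AddChar F ℂ) (ρ : SpecialLinearGroup (Fin 2) F →* Matrix (Fin d) (Fin d) ℂ)
    [Fintype F] where
  mult : F → ℕ
  inc : ∀ a, Matrix (Fin d) (Fin (mult a)) ℂ
  coord : ∀ a, Matrix (Fin (mult a)) (Fin d) ℂ
  coord_mul_inc : ∀ a, coord a * inc a = 1
  upper_mul_inc : ∀ a x, ρ (upper x) * inc a = ψ (a * x) • inc a
  coord_mul_upper : ∀ a x, coord a * ρ (upper x) = ψ (a * x) • coord a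
  sum_inc_mul_coord : ∑ a, inc a * coord a = 1
  torus_mul : ∀ (a : F) (t : Fˣ), ρ (torus t) * (inc a * coord a) =
    inc (a * ((t⁻¹ ^ 2 : Fˣ) : F)) * coord (a * ((t⁻¹ ^ 2 : Fˣ) : F)) * ρ (torus t)

variable [Fintype F] {ψ : AddChar F ℂ}
  {ρ : SpecialLinearGroup (Fin 2) F →* Matrix (Fin d) (Fin d) ℂ}

theorem exists_frame (hψ : ψ.IsPrimitive)
    (ρ : SpecialLinearGroup (Fin 2) F →* Matrix (Fin d) (Fin d) ℂ) : Nonempty (Frame ψ ρ) := by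
  classical
  have hq : (Fintype.card F : ℂ) ≠ 0 := by exact_mod_cast Fintype.card_ne_zero
  -- `P a` is the projection to the eigenspace of `x ↦ ψ (a * x)`
  let P : F → Matrix (Fin d) (Fin d) ℂ := fun a =>
    (Fintype.card F : ℂ)⁻¹ • ∑ x, ψ (-(a * x)) • ρ (upper x)
  have hleft : ∀ a y, ρ (upper y) * P a = ψ (a * y) • P a := by
    intro a y
    simp only [P, Matrix.mul_smul, Matrix.mul_sum, Finset.smul_sum, smul_smul]
    refine Fintype.sum_equiv (Equiv.addLeft y) _ _ fun x => ?_
    simp only [Equiv.coe_addLeft, upper_add, map_mul]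
    congr 1
    rw [mul_left_comm, ← AddChar.map_add_eq_mul]
    congr 2
    ring
  have hright : ∀ a y, P a * ρ (upper y) = ψ (a * y) • P a := by
    intro a y
    simp only [P, Matrix.smul_mul, Matrix.sum_mul, Finset.smul_sum, smul_smul]
    refine Fintype.sum_equiv (Equiv.addRight y) _ _ fun x => ?_
    simp only [Equiv.coe_addRight, upper_add, map_mul]
    congr 1
    rw [mul_left_comm, ← AddChar.map_add_eq_mul]
    congr 2
    ring
  have hidem : ∀ a, P a * P a = P a := by
    intro a
    have : P a * P a = (Fintype.card F : ℂ)⁻¹ • ∑ x, ψ (-(a * x)) • (ρ (upper x) * P a) := by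
      conv_lhs => enter [1]; simp only [P]
      simp only [Matrix.smul_mul, Matrix.sum_mul]
    rw [this]
    simp only [hleft, smul_smul, ← AddChar.map_add_eq_mul, neg_add_cancel, AddChar.map_zero_eq_one,
      one_smul, Finset.sum_const, Finset.card_univ]
    rw [← Nat.cast_smul_eq_nsmul ℂ, smul_smul, inv_mul_cancel₀ hq, one_smul]
  have hsum : ∑ a, P a = 1 := by
    simp only [P, ← Finset.smul_sum]
    rw [Finset.sum_comm]
    simp only [← Finset.sum_smul]
    have h1 : ∀ x : F, ∑ a, ψ (-(a * x)) = if x = 0 then (Fintype.card F : ℂ) else 0 := by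
      intro x
      have := AddChar.sum_mulShift (-x) hψ
      simpa only [mul_neg, neg_eq_zero, Nat.cast_ite, Nat.cast_zero] using this
    simp only [h1, ite_smul, zero_smul, Finset.sum_ite_eq', Finset.mem_univ, if_true, upper_zero,
      map_one, smul_smul, inv_mul_cancel₀ hq, one_smul]
  have htorus : ∀ (a : F) (t : Fˣ), ρ (torus t) * P a = P (a * ((t⁻¹ ^ 2 : Fˣ) : F)) * ρ (torus t) := by
    intro a t
    simp only [P, Matrix.mul_smul, Matrix.smul_mul, Matrix.mul_sum, Matrix.sum_mul, ← map_mul,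
      torus_mul_upper]
    congr 1
    refine Fintype.sum_equiv (Equiv.mulLeft₀ ((t : F) ^ 2) (by simp)) _ _ fun x => ?_
    rw [Equiv.mulLeft₀_apply]
    congr 3
    simp only [Units.val_pow_eq_pow_val, Units.val_inv_eq_inv_val]
    field_simp
  choose m B C hBC hCB using fun a => exists_factor_of_idempotent (P a) (hidem a)
  have hB : ∀ a, P a * B a = B a := fun a => by rw [← hBC, Matrix.mul_assoc, hCB, Matrix.mul_one]
  have hC : ∀ a, C a * P a = C a := fun a => by rw [← hBC, ← Matrix.mul_assoc, hCB, Matrix.one_mul]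
  exact ⟨{ mult := m, inc := B, coord := C
           coord_mul_inc := hCB
           upper_mul_inc := fun a x => by
            rw [← hB, ← Matrix.mul_assoc, hleft, Matrix.smul_mul]
           coord_mul_upper := fun a x => by
            rw [← hC, Matrix.mul_assoc, hright, Matrix.mul_smul]
           sum_inc_mul_coord := by simp only [hBC, hsum]
           torus_mul := fun a t => by simp only [hBC, htorus] }⟩

namespace Frame

/-- The eigenspace decomposition, with each eigenspace transported by the torus from one chosen in
its orbit. -/
theorem sum_torus_conj (D : Frame ψ ρ) {r : F → F} {t : F → Fˣ}
    (h : ∀ a, a = r a * (((t a)⁻¹ ^ 2 : Fˣ) : F)) :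
    ∑ a, ρ (torus (t a)) * D.inc (r a) * (D.coord (r a) * ρ (torus (t a)⁻¹)) = 1 := by
  rw [← D.sum_inc_mul_coord]
  refine Finset.sum_congr rfl fun a _ => ?_
  rw [← Matrix.mul_assoc, Matrix.mul_assoc (ρ _), D.torus_mul, ← h, Matrix.mul_assoc, ← map_mul,
    ← GenDFT.torus_mul, mul_inv_cancel, torus_one, map_one, Matrix.mul_one]

/-- The transported bases have `d` vectors in all: compare traces in `sum_torus_conj`. -/
theorem sum_mult (D : Frame ψ ρ) {r : F → F} {t : F → Fˣ}
    (h : ∀ a, a = r a * (((t a)⁻¹ ^ 2 : Fˣ) : F)) : ∑ a, D.mult (r a) = d := by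
  have h1 := congrArg Matrix.trace (D.sum_torus_conj h)
  rw [Matrix.trace_sum, Matrix.trace_one, Fintype.card_fin] at h1
  have h2 : ∀ a, (ρ (torus (t a)) * D.inc (r a) *
      (D.coord (r a) * ρ (torus (t a)⁻¹))).trace = (D.mult (r a) : ℂ) := by
    intro a
    rw [Matrix.trace_mul_comm, Matrix.mul_assoc, ← Matrix.mul_assoc (ρ _), ← map_mul,
      ← GenDFT.torus_mul, inv_mul_cancel, torus_one, map_one, Matrix.one_mul, D.coord_mul_inc,
      Matrix.trace_one, Fintype.card_fin]
  simp only [h2] at h1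
  exact_mod_cast h1

end Frame

/-- The coefficients of the irreducible representations that transform by given characters of the
unipotent subgroup on both sides are determined by their values on representatives of the
`2 (q - 1)` double cosets, and they are linearly independent; this bounds their number. -/
theorem sum_mult_mul_mult_le [DecidableEq F] (R : IrrepSet (SpecialLinearGroup (Fin 2) F))
    (D : ∀ i, Frame ψ (R.rep i)) (a b : F) :
    ∑ i, (D i).mult a * (D i).mult b ≤ 2 * Fintype.card F := by
  let f : (∀ i, Matrix (Fin ((D i).mult b)) (Fin ((D i).mult a)) ℂ) →ₗ[ℂ]
      (SpecialLinearGroup (Fin 2) F → ℂ) :=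
    { toFun := fun Y g => ∑ i, ((D i).inc b * Y i * (D i).coord a * R.rep i g).trace
      map_add' := fun Y Z => by
        funext g
        simp [Matrix.add_mul, Matrix.mul_add, Finset.sum_add_distrib]
      map_smul' := fun c Y => by
        funext g
        simp [Finset.mul_sum] }
  have hf : ∀ Y, f Y = 0 → Y = 0 := by
    intro Y hY
    have := eq_zero_of_sum_trace_eq_zero R.irreducible R.distinct Finset.univ
      (fun i => (D i).inc b * Y i * (D i).coord a) (fun g => congrFun hY g)
    funext i
    have h1 := congrArg (fun M => (D i).coord b * M * (D i).inc a) (this i (Finset.mem_univ i))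
    simp only [Matrix.mul_zero, Matrix.zero_mul] at h1
    rw [Matrix.mul_assoc, Matrix.mul_assoc, Matrix.mul_assoc, (D i).coord_mul_inc,
      Matrix.mul_one, ← Matrix.mul_assoc, (D i).coord_mul_inc, Matrix.one_mul] at h1
    exact h1
  have hleft : ∀ Y x g, f Y (upper x * g) = ψ (a * x) * f Y g := by
    intro Y x g
    simp only [f, LinearMap.coe_mk, AddHom.coe_mk, Finset.mul_sum]
    refine Finset.sum_congr rfl fun i _ => ?_
    rw [map_mul, ← Matrix.mul_assoc, Matrix.mul_assoc _ _ (R.rep i (upper x)),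
      (D i).coord_mul_upper, Matrix.mul_smul, Matrix.smul_mul, Matrix.trace_smul, smul_eq_mul]
  have hright : ∀ Y y g, f Y (g * upper y) = ψ (b * y) * f Y g := by
    intro Y y g
    simp only [f, LinearMap.coe_mk, AddHom.coe_mk, Finset.mul_sum]
    refine Finset.sum_congr rfl fun i _ => ?_
    rw [map_mul, ← Matrix.mul_assoc, Matrix.trace_mul_comm]
    simp only [← Matrix.mul_assoc]
    rw [(D i).upper_mul_inc]
    simp only [Matrix.smul_mul, Matrix.trace_smul, smul_eq_mul]
  let res : (SpecialLinearGroup (Fin 2) F → ℂ) →ₗ[ℂ] (Fˣ ⊕ Fˣ → ℂ) :=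
    LinearMap.funLeft ℂ ℂ (Sum.elim (fun t => torus t * weyl F) torus)
  have hinj : Function.Injective (res ∘ₗ f) := by
    rw [← LinearMap.ker_eq_bot, LinearMap.ker_eq_bot']
    intro Y hY
    apply hf
    funext g
    obtain ⟨p, rfl⟩ := bruhat_surjective g
    rcases p with ⟨x, t, y⟩ | ⟨x, t⟩
    · have := congrFun hY (.inl t)
      simp only [res, LinearMap.comp_apply, LinearMap.funLeft_apply, Sum.elim_inl] at this
      simp only [bruhat]
      rw [hright, mul_assoc, hleft, this]
      simp
    · have := congrFun hY (.inr t)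
      simp only [res, LinearMap.comp_apply, LinearMap.funLeft_apply, Sum.elim_inr] at this
      simp only [bruhat]
      rw [hleft, this]
      simp
  have := LinearMap.finrank_le_finrank_of_injective hinj
  rw [Module.finrank_pi_fintype] at this
  simp only [Module.finrank_matrix, Fintype.card_fin, Module.finrank_self, mul_one,
    Module.finrank_fintype_fun_eq_card, Fintype.card_sum, Fintype.card_units] at this
  calc ∑ i, (D i).mult a * (D i).mult b = ∑ i, (D i).mult b * (D i).mult a :=
        Finset.sum_congr rfl fun i _ => mul_comm _ _
    _ ≤ _ := this
    _ ≤ _ := by omega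

end Frame


/-! ### The Fourier transform of the big cell -/

section Algorithm

open Matrix

variable {F : Type*} [Field F] [Fintype F] {ψ : AddChar F ℂ}

namespace Frame

variable {d : ℕ} {ρ : SpecialLinearGroup (Fin 2) F →* Matrix (Fin d) (Fin d) ℂ}
  {r : F → F} {t : F → Fˣ}

/-- A matrix recovered from its blocks between two bases of eigenvectors: the one transported by
the torus on the left, and the original one on the right. -/
theorem apply_eq_sum (D : Frame ψ ρ) (h : ∀ a, a = r a * (((t a)⁻¹ ^ 2 : Fˣ) : F))
    (N : Matrix (Fin d) (Fin d) ℂ) (k l : Fin d) :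
    N k l = ∑ p : (a : F) × Fin (D.mult (r a)), (ρ (torus (t p.1)) * D.inc (r p.1)) k p.2 *
      ∑ p' : (b : F) × Fin (D.mult b),
        (D.coord (r p.1) * ρ (torus (t p.1)⁻¹) * N * D.inc p'.1) p.2 p'.2 * D.coord p'.1 p'.2 l := by
  have h1 : N = ∑ a, ρ (torus (t a)) * D.inc (r a) *
      ∑ b, (D.coord (r a) * ρ (torus (t a)⁻¹) * N * D.inc b) * D.coord b := by
    have h2 : ∀ a, ∑ b, (D.coord (r a) * ρ (torus (t a)⁻¹) * N * D.inc b) * D.coord b =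
        D.coord (r a) * ρ (torus (t a)⁻¹) * N := by
      intro a
      simp only [Matrix.mul_assoc _ (D.inc _), ← Matrix.mul_sum, D.sum_inc_mul_coord,
        Matrix.mul_one]
    simp only [h2, ← Matrix.mul_assoc _ _ N, ← Matrix.sum_mul, D.sum_torus_conj h,
      Matrix.one_mul]
  conv_lhs => rw [h1]
  rw [Matrix.sum_apply, Fintype.sum_sigma]
  refine Finset.sum_congr rfl fun a _ => ?_
  rw [Matrix.mul_apply]
  refine Finset.sum_congr rfl fun i _ => ?_
  rw [Matrix.sum_apply, Fintype.sum_sigma]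
  exact congrArg _ (Finset.sum_congr rfl fun b _ => Matrix.mul_apply)

/-- On the big cell, each block is obtained from the Fourier transforms in the two unipotent
variables by a sum over the torus whose kernel depends only on the chosen element `r a` of the
torus orbit of `a`. -/
theorem block_eq_sum [DecidableEq F] (D : Frame ψ ρ) (h : ∀ a, a = r a * (((t a)⁻¹ ^ 2 : Fˣ) : F))
    (A : F → Fˣ → F → ℂ) (a b : F) :
    D.coord (r a) * ρ (torus (t a)⁻¹) *
        (∑ x, ∑ s, ∑ y, A x s y • ρ (upper x * torus s * weyl F * upper y)) * D.inc b =
      ∑ s, (∑ y, (∑ x, ψ (a * x) * A x (t a * s) y) * ψ (b * y)) •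
        (D.coord (r a) * ρ (torus s * weyl F) * D.inc b) := by
  have term : ∀ x s y, D.coord (r a) * ρ (torus (t a)⁻¹) *
      ρ (upper x * torus s * weyl F * upper y) * D.inc b =
      (ψ (a * x) * ψ (b * y)) • (D.coord (r a) * ρ (torus ((t a)⁻¹ * s) * weyl F) * D.inc b) := by
    intro x s y
    have e1 : torus (t a)⁻¹ * (upper x * torus s * weyl F * upper y) =
        upper (((t a)⁻¹ ^ 2 : Fˣ) * x) * (torus ((t a)⁻¹ * s) * weyl F) * upper y := by
      rw [GenDFT.torus_mul, ← mul_assoc, ← mul_assoc, ← mul_assoc, torus_mul_upper]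
      simp only [mul_assoc, Units.val_pow_eq_pow_val]
    rw [Matrix.mul_assoc _ (ρ _) (ρ _), ← map_mul, e1, map_mul, map_mul, ← Matrix.mul_assoc,
      ← Matrix.mul_assoc, D.coord_mul_upper, Matrix.mul_assoc _ (ρ (upper y)), D.upper_mul_inc,
      Matrix.mul_smul, Matrix.smul_mul, Matrix.smul_mul, smul_smul, ← mul_assoc (r a), ← h a,
      mul_comm (ψ _)]
  simp only [Matrix.mul_sum, Matrix.sum_mul, Matrix.mul_smul, Matrix.smul_mul, term, smul_smul]
  rw [Finset.sum_comm]
  symm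
  refine Fintype.sum_equiv (Equiv.mulLeft (t a)) _ _ fun s => ?_
  simp only [Equiv.coe_mulLeft, inv_mul_cancel_left, Finset.sum_mul, Finset.sum_smul]
  rw [Finset.sum_comm]
  refine Finset.sum_congr rfl fun x _ => Finset.sum_congr rfl fun y _ => ?_
  congr 1
  ring

end Frame

variable [DecidableEq F]

theorem mem_iUnion_range_union {X ι Z : Type*} {κ : ι → Type*} (f : ∀ i, κ i → X → Z) (i : ι)
    (k : κ i) (T : Set (X → Z)) : f i k ∈ (⋃ i, Set.range (f i)) ∪ T :=
  .inl (Set.mem_iUnion.2 ⟨i, k, rfl⟩)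

/-- The cost of the Fourier transform of a function supported on the big cell. The two Fourier
transforms in the unipotent variables are `2 (q - 1)` matrix products of size `q`; for each orbit
representative on the left and each character on the right, the sum over the torus is one matrix
product of size at most `2 q`, for all representations together; two more products per
representation change the bases. -/
theorem cost_bigCell (hψ : ψ.IsPrimitive) (R : IrrepSet (SpecialLinearGroup (Fin 2) F))
    {mm : ℕ → ℝ} (hmm : ∀ n, ComputableWithin (matMul n) (mm n)) {X : Type*} {S : Set (X → ℂ)}
    (A : F → Fˣ → F → X → ℂ) (hA : ∀ x s y, A x s y ∈ S ∪ Set.range (Function.const X)) :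
    Cost S (Set.range fun (e : R.Entry) z =>
        (∑ x, ∑ s, ∑ y, A x s y z • R.rep e.1 (upper x * torus s * weyl F * upper y)) e.2.1 e.2.2)
      (2 * (Fintype.card F * mm (Fintype.card F)) +
        3 * (Fintype.card F * mm (2 * Fintype.card F)) + 2 * ∑ i, mm (R.dim i)) := by
  obtain ⟨e, cl, t, ht⟩ := exists_square_classes F
  let D : ∀ i, Frame ψ (R.rep i) := fun i => (exists_frame hψ (R.rep i)).some
  set q := Fintype.card F with hq
  have mm0 : ∀ n, 0 ≤ mm n := fun n => (by positivity : (0 : ℝ) ≤ (n : ℝ) ^ 2).trans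
    (sq_le_of_computableWithin (hmm n))
  have hunits : Fintype.card Fˣ ≤ q := by rw [Fintype.card_units]; omega
  have units_le : ∀ c : ℝ, 0 ≤ c → (∑ _s : Fˣ, c) ≤ q * c := by
    intro c hc
    rw [Finset.sum_const, Finset.card_univ, nsmul_eq_mul]
    exact mul_le_mul_of_nonneg_right (by exact_mod_cast hunits) hc
  -- the Fourier transform in the first variable, then in the second
  let A1 : Fˣ → F × F → X → ℂ := fun s p z => ∑ x, ψ (p.1 * x) * A x s p.2 z
  let A2 : Fˣ → F × F → X → ℂ := fun s p z => ∑ y, A1 s (p.1, y) z * ψ (p.2 * y)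
  have c1' : ∀ s, Cost S (Set.range (A1 s)) (mm q) := fun s =>
    Cost.matMul (hmm q) le_rfl le_rfl le_rfl
      (fun a x => Function.const X (ψ (a * x))) (fun x y => A x s y)
      (fun a x => .inr ⟨_, rfl⟩) (fun x y => hA x s y)
  have c1 := (Cost.iUnion c1').mono_le (units_le _ (mm0 q))
  have c2' : ∀ s, Cost (⋃ s, Set.range (A1 s)) (Set.range (A2 s)) (mm q) := fun s =>
    Cost.matMul (hmm q) le_rfl le_rfl le_rfl
      (fun a y => A1 s (a, y)) (fun y b => Function.const X (ψ (b * y)))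
      (fun a y => mem_iUnion_range_union A1 s (a, y) _) (fun y b => .inr ⟨_, rfl⟩)
  have c2 := (Cost.iUnion c2').mono_le (units_le _ (mm0 q))
  -- `J p` indexes the pairs of basis vectors, of all representations together, in the eigenspaces
  -- of the representative `e p.1` on the left and of `p.2` on the right
  let J : Fin 3 × F → Type := fun p =>
    (i : Fin R.num) × (Fin ((D i).mult (e p.1)) × Fin ((D i).mult p.2))
  have hJ : ∀ p, Fintype.card (J p) ≤ 2 * q := fun p => by
    simpa only [J, Fintype.card_sigma, Fintype.card_prod, Fintype.card_fin] using
      sum_mult_mul_mult_le R D (e p.1) p.2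
  let E : ∀ p : Fin 3 × F, F × J p → X → ℂ := fun p m z =>
    ∑ s, A2 (t m.1 * s) (m.1, p.2) z *
      ((D m.2.1).coord (e p.1) * R.rep m.2.1 (torus s * weyl F) * (D m.2.1).inc p.2)
        m.2.2.1 m.2.2.2
  have c3' : ∀ p, Cost (⋃ s, Set.range (A2 s)) (Set.range (E p)) (mm (2 * q)) := fun p =>
    Cost.matMul (K := J p) (hmm (2 * q)) (show q ≤ 2 * q by omega) (hunits.trans (by omega)) (hJ p)
      (fun a s => A2 (t a * s) (a, p.2))
      (fun s m => Function.const X (((D m.1).coord (e p.1) * R.rep m.1 (torus s * weyl F) *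
          (D m.1).inc p.2) m.2.1 m.2.2))
      (fun a s => mem_iUnion_range_union A2 (t a * s) (a, p.2) _)
      (fun s m => .inr ⟨_, rfl⟩)
  have c3 : Cost (⋃ s, Set.range (A2 s)) (⋃ p, Set.range (E p)) (3 * (q * mm (2 * q))) := by
    refine (Cost.iUnion c3').mono_le ?_
    rw [Finset.sum_const, Finset.card_univ, Fintype.card_prod, Fintype.card_fin, nsmul_eq_mul, ← hq]
    push_cast
    exact (mul_assoc _ _ _).le
  -- `E` holds the blocks of every representation, with respect to the two bases of `apply_eq_sum`
  have hE : ∀ (i : Fin R.num) (p : (a : F) × Fin ((D i).mult (e (cl a))))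
      (p' : (b : F) × Fin ((D i).mult b)),
      E (cl p.1, p'.1) (p.1, ⟨i, p.2, p'.2⟩) = fun z =>
        ((D i).coord (e (cl p.1)) * R.rep i (torus (t p.1)⁻¹) *
          (∑ x, ∑ s, ∑ y, A x s y z • R.rep i (upper x * torus s * weyl F * upper y)) *
          (D i).inc p'.1) p.2 p'.2 := by
    intro i p p'
    funext z
    rw [(D i).block_eq_sum (r := fun a => e (cl a)) ht, Matrix.sum_apply]
    rfl
  have hcard : ∀ i, Fintype.card ((a : F) × Fin ((D i).mult (e (cl a)))) = R.dim i := by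
    intro i
    simpa only [Fintype.card_sigma, Fintype.card_fin] using
      (D i).sum_mult (r := fun a => e (cl a)) ht
  have hcard' : ∀ i, Fintype.card ((b : F) × Fin ((D i).mult b)) = R.dim i := by
    intro i
    simpa only [Fintype.card_sigma, Fintype.card_fin] using
      (D i).sum_mult (r := fun a => a) (t := fun _ => 1) (by simp)
  let Y : ∀ i, ((a : F) × Fin ((D i).mult (e (cl a)))) × Fin (R.dim i) → X → ℂ := fun i p z =>
    ∑ p' : (b : F) × Fin ((D i).mult b),
      E (cl p.1.1, p'.1) (p.1.1, ⟨i, p.1.2, p'.2⟩) z * (D i).coord p'.1 p'.2 p.2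
  have c4' : ∀ i, Cost (⋃ p, Set.range (E p)) (Set.range (Y i)) (mm (R.dim i)) := fun i =>
    Cost.matMul (hmm (R.dim i)) (hcard i).le (hcard' i).le (by simp)
      (fun p p' => E (cl p.1, p'.1) (p.1, ⟨i, p.2, p'.2⟩))
      (fun p' l => Function.const X ((D i).coord p'.1 p'.2 l))
      (fun p p' => mem_iUnion_range_union E (cl p.1, p'.1) (p.1, ⟨i, p.2, p'.2⟩) _)
      (fun p' l => .inr ⟨_, rfl⟩)
  have c4 := Cost.iUnion c4'
  let Z : ∀ i, Fin (R.dim i) × Fin (R.dim i) → X → ℂ := fun i k z =>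
    ∑ p : (a : F) × Fin ((D i).mult (e (cl a))),
      (R.rep i (torus (t p.1)) * (D i).inc (e (cl p.1))) k.1 p.2 * Y i (p, k.2) z
  have c5' : ∀ i, Cost (⋃ i, Set.range (Y i)) (Set.range (Z i)) (mm (R.dim i)) := fun i =>
    Cost.matMul (hmm (R.dim i)) (by simp) (hcard i).le (by simp)
      (fun k p => Function.const X ((R.rep i (torus (t p.1)) * (D i).inc (e (cl p.1))) k p.2))
      (fun p l => Y i (p, l))
      (fun k p => .inr ⟨_, rfl⟩) (fun p l => mem_iUnion_range_union Y i (p, l) _)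
  have c5 := Cost.iUnion c5'
  refine ((((c1.trans c2).trans c3).trans c4).trans c5).mono subset_rfl ?_ (by linarith)
  rintro _ ⟨⟨i, k, l⟩, rfl⟩
  refine Set.mem_iUnion.2 ⟨i, (k, l), funext fun z => ?_⟩
  simp only [Z, Y, hE]
  exact ((D i).apply_eq_sum (r := fun a => e (cl a)) ht _ k l).symm

/-- The cost of the whole transform: the small cell `upper x * torus s` is brought into the big
cell by multiplying with the Weyl element on the right. -/
theorem computableWithin_dft (R : IrrepSet (SpecialLinearGroup (Fin 2) F))
    {mm : ℕ → ℝ} (hmm : ∀ n, ComputableWithin (matMul n) (mm n)) :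
    ComputableWithin (dft R)
      (2 * (2 * (Fintype.card F * mm (Fintype.card F)) +
        3 * (Fintype.card F * mm (2 * Fintype.card F)) + 2 * ∑ i, mm (R.dim i)) +
        ∑ i, mm (R.dim i) + ∑ i, (R.dim i : ℝ) ^ 2) := by
  apply Cost.computableWithin
  have hψ := AddChar.FiniteField.primitiveChar_to_Complex_isPrimitive F
  set S : Set ((SpecialLinearGroup (Fin 2) F → ℂ) → ℂ) :=
    Set.range fun (g : SpecialLinearGroup (Fin 2) F) (c : SpecialLinearGroup (Fin 2) F → ℂ) => c g
  let A : F → Fˣ → F → (SpecialLinearGroup (Fin 2) F → ℂ) → ℂ := fun x s y c =>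
    c (bruhat (.inl (x, s, y)))
  let A' : F → Fˣ → F → (SpecialLinearGroup (Fin 2) F → ℂ) → ℂ := fun x s y =>
    if y = 0 then fun c => c (bruhat (.inr (x, s))) else 0
  have c1 := cost_bigCell hψ R hmm (S := S) A fun x s y => .inl ⟨_, rfl⟩
  have c2 := cost_bigCell hψ R hmm (S := S) A' fun x s y => by
    by_cases hy : y = 0
    · exact .inl ⟨bruhat (.inr (x, s)), by simp only [A', if_pos hy]⟩
    · exact .inr ⟨0, by simp only [A', if_neg hy]; rfl⟩
  set P : R.Entry → (SpecialLinearGroup (Fin 2) F → ℂ) → ℂ := fun e z =>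
    (∑ x, ∑ s, ∑ y, A x s y z • R.rep e.1 (upper x * torus s * weyl F * upper y)) e.2.1 e.2.2
    with hP
  set P' : R.Entry → (SpecialLinearGroup (Fin 2) F → ℂ) → ℂ := fun e z =>
    (∑ x, ∑ s, ∑ y, A' x s y z • R.rep e.1 (upper x * torus s * weyl F * upper y)) e.2.1 e.2.2
    with hP'
  let Q : R.Entry → (SpecialLinearGroup (Fin 2) F → ℂ) → ℂ := fun e z =>
    ∑ j, P' ⟨e.1, e.2.1, j⟩ z * R.rep e.1 (weyl F)⁻¹ j e.2.2
  have c3 : Cost (Set.range P ∪ Set.range P') (Set.range Q) (∑ i, mm (R.dim i)) := by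
    refine (Cost.iUnion fun i => Cost.matMul (hmm (R.dim i)) (by simp) (by simp) (by simp)
      (fun (k j : Fin (R.dim i)) => P' ⟨i, k, j⟩)
      (fun j (l : Fin (R.dim i)) => Function.const _ (R.rep i (weyl F)⁻¹ j l))
      (fun k j => .inl (.inr ⟨_, rfl⟩)) (fun j l => .inr ⟨_, rfl⟩)).mono_target ?_
    rintro _ ⟨⟨i, k, l⟩, rfl⟩
    exact Set.mem_iUnion.2 ⟨i, (k, l), rfl⟩
  have c4 : Cost (Set.range P ∪ (Set.range P ∪ Set.range P'))
      (Set.range P ∪ Set.range Q) (0 + ∑ i, mm (R.dim i)) :=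
    (Cost.of_subset Set.subset_union_left).union (c3.mono Set.subset_union_right subset_rfl le_rfl)
  rw [← Set.union_assoc, Set.union_self] at c4
  have c5 : Cost (Set.range P ∪ Set.range Q) (Set.range fun e => P e + Q e)
      (Fintype.card R.Entry * 1) :=
    Cost.range fun e => Cost.add (.inl ⟨e, rfl⟩) (.inr ⟨e, rfl⟩)
  refine (((c1.union c2).trans c4).trans c5).mono subset_rfl ?_ ?_
  · rintro _ ⟨⟨i, k, l⟩, rfl⟩
    refine ⟨⟨i, k, l⟩, funext fun z => ?_⟩
    have hQ : Q ⟨i, k, l⟩ z = ((∑ x, ∑ s, ∑ y,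
        A' x s y z • R.rep i (upper x * torus s * weyl F * upper y)) * R.rep i (weyl F)⁻¹) k l := by
      rw [Matrix.mul_apply]
    have hQ' : (∑ x, ∑ s, ∑ y, A' x s y z • R.rep i (upper x * torus s * weyl F * upper y)) *
        R.rep i (weyl F)⁻¹ = ∑ x, ∑ s, z (bruhat (.inr (x, s))) • R.rep i (bruhat (.inr (x, s))) := by
      simp only [Matrix.sum_mul]
      refine Finset.sum_congr rfl fun x _ => Finset.sum_congr rfl fun s _ => ?_
      rw [Finset.sum_eq_single 0]
      · rw [Matrix.smul_mul, ← map_mul, upper_zero, mul_one, mul_inv_cancel_right]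
        simp [A', bruhat]
      · intro y _ hy
        simp [A', hy]
      · simp
    change P ⟨i, k, l⟩ z + Q ⟨i, k, l⟩ z = (∑ g, z g • R.rep i g) k l
    rw [hQ, hQ', hP]
    simp only
    rw [← Matrix.add_apply]
    rw [← bruhat_bijective.sum_comp fun g => z g • R.rep i g, Fintype.sum_sum_type]
    simp only [Fintype.sum_prod_type]
    rfl
  · rw [Fintype.card_sigma]
    simp only [Fintype.card_prod, Fintype.card_fin, Nat.cast_sum, ← sq,
      mul_one]
    push_cast
    linarith

end Algorithm

/-! ### The exponent -/

/-- One product of the size of each representation fits the bound: as each `d i ^ 2` is at most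
`g`, `d i ^ τ` is at most `d i ^ 2 * g ^ (τ / 2 - 1)`. -/
theorem sum_rpow_le {ι : Type*} (s : Finset ι) (d : ι → ℕ) {g : ℕ} (hd : ∀ i ∈ s, 0 < d i)
    (h : ∑ i ∈ s, d i ^ 2 ≤ g) {τ : ℝ} (hτ : 2 ≤ τ) :
    ∑ i ∈ s, (d i : ℝ) ^ τ ≤ (g : ℝ) ^ (τ / 2) := by
  have h' : ∑ i ∈ s, (d i : ℝ) ^ 2 ≤ g := by exact_mod_cast h
  rcases Nat.eq_zero_or_pos g with rfl | hg
  · have hs : s = ∅ := by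
      by_contra hne
      obtain ⟨i, hi⟩ := Finset.nonempty_iff_ne_empty.2 hne
      have := Finset.single_le_sum (f := fun i => d i ^ 2) (fun _ _ => Nat.zero_le _) hi
      have := hd i hi
      have : 0 < d i ^ 2 := by positivity
      omega
    subst hs
    simpa using Real.rpow_nonneg le_rfl _
  have hg' : (0 : ℝ) < g := by exact_mod_cast hg
  calc ∑ i ∈ s, (d i : ℝ) ^ τ ≤ ∑ i ∈ s, (d i : ℝ) ^ 2 * (g : ℝ) ^ (τ / 2 - 1) := by
        refine Finset.sum_le_sum fun i hi => ?_
        have hdi : (0 : ℝ) < d i := by exact_mod_cast hd i hi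
        have h1 : (d i : ℝ) ^ 2 ≤ g :=
          (Finset.single_le_sum (f := fun i => (d i : ℝ) ^ 2) (fun _ _ => by positivity) hi).trans h'
        have h2 : (d i : ℝ) ^ τ = (d i : ℝ) ^ 2 * ((d i : ℝ) ^ 2) ^ (τ / 2 - 1) := by
          rw [← Real.rpow_natCast, ← Real.rpow_mul hdi.le, ← Real.rpow_add hdi]
          congr 1
          push_cast
          ring
        rw [h2]
        exact mul_le_mul_of_nonneg_left
          (Real.rpow_le_rpow (by positivity) h1 (by linarith)) (by positivity)
    _ = (∑ i ∈ s, (d i : ℝ) ^ 2) * (g : ℝ) ^ (τ / 2 - 1) := (Finset.sum_mul _ _ _).symm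
    _ ≤ g * (g : ℝ) ^ (τ / 2 - 1) := mul_le_mul_of_nonneg_right h' (Real.rpow_nonneg hg'.le _)
    _ = (g : ℝ) ^ (τ / 2) := by
        rw [mul_comm, ← Real.rpow_add_one hg'.ne']
        congr 1
        ring

/-- `O(q)` products of size `q` fit the bound, because `τ + 1 ≤ 3 τ / 2`. -/
theorem mul_rpow_le {q g : ℕ} (hq : 0 < q) (h : q ^ 3 ≤ 2 * g) {τ : ℝ} (hτ : 2 ≤ τ) :
    (q : ℝ) * (q : ℝ) ^ τ ≤ 2 ^ (τ / 2) * (g : ℝ) ^ (τ / 2) := by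
  have hq' : (0 : ℝ) < q := by exact_mod_cast hq
  have hq1 : (1 : ℝ) ≤ q := by exact_mod_cast hq
  have h' : (q : ℝ) ^ 3 ≤ 2 * g := by exact_mod_cast h
  calc (q : ℝ) * (q : ℝ) ^ τ = (q : ℝ) ^ (τ + 1) := by rw [Real.rpow_add_one hq'.ne', mul_comm]
    _ ≤ (q : ℝ) ^ (3 * (τ / 2)) := Real.rpow_le_rpow_of_exponent_le hq1 (by linarith)
    _ = ((q : ℝ) ^ 3) ^ (τ / 2) := by
        rw [Real.rpow_mul hq'.le]
        norm_cast
    _ ≤ (2 * g) ^ (τ / 2) := Real.rpow_le_rpow (by positivity) h' (by linarith)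
    _ = 2 ^ (τ / 2) * (g : ℝ) ^ (τ / 2) := Real.mul_rpow (by norm_num) (by positivity)

end GenDFT
end

theorem theorem5p5 (ε : ℝ) (hε : 0 < ε) :
    ∃ c : ℝ, ∀ (F : Type*) [Field F] [Fintype F] [DecidableEq F],
      Nonempty (GenDFT.IrrepSet (Matrix.SpecialLinearGroup (Fin 2) F)) ∧
      ∀ R : GenDFT.IrrepSet (Matrix.SpecialLinearGroup (Fin 2) F),
        GenDFT.ComputableWithin (GenDFT.dft R)
          (c * (Fintype.card (Matrix.SpecialLinearGroup (Fin 2) F) : ℝ) ^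
            (GenDFT.omega / 2 + ε)) := by
  obtain ⟨τ, b, hτ2, hτ, hb, hmm⟩ := GenDFT.exists_exponent (show 0 < 2 * ε by linarith)
  set K : ℝ := b * (4 + 6 * 2 ^ τ) * 2 ^ (τ / 2) + 5 * b + 1 with hK
  refine ⟨K, fun F _ _ _ => ⟨GenDFT.nonempty_irrepSet _, fun R => ?_⟩⟩
  obtain ⟨C, hC, hCeval⟩ := GenDFT.computableWithin_dft R hmm
  refine ⟨C, hC.trans ?_, hCeval⟩
  set g := Fintype.card (Matrix.SpecialLinearGroup (Fin 2) F) with hg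
  set q := Fintype.card F with hq
  have hg1 : (1 : ℝ) ≤ g := by exact_mod_cast (Fintype.card_pos : 0 < g)
  have hdim := GenDFT.sum_sq_dim_le R.irreducible R.distinct Finset.univ
  have h1 := GenDFT.sum_rpow_le Finset.univ R.dim
    (fun i _ => GenDFT.pos_of_isIrreducible (R.irreducible i)) hdim hτ2
  have h2 : ∑ i, (R.dim i : ℝ) ^ 2 ≤ (g : ℝ) ^ (τ / 2) := by
    have := GenDFT.sum_rpow_le Finset.univ R.dim
      (fun i _ => GenDFT.pos_of_isIrreducible (R.irreducible i)) hdim le_rfl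
    have h3 : (g : ℝ) ^ ((2 : ℝ) / 2) ≤ (g : ℝ) ^ (τ / 2) :=
      Real.rpow_le_rpow_of_exponent_le hg1 (by linarith)
    simpa using this.trans h3
  have h3 := GenDFT.mul_rpow_le (Fintype.card_pos : 0 < q) GenDFT.card_pow_three_le hτ2
  have h4 : ((2 * q : ℕ) : ℝ) ^ τ = 2 ^ τ * (q : ℝ) ^ τ := by
    push_cast
    exact Real.mul_rpow (by norm_num) (by positivity)
  have h5 : (g : ℝ) ^ (τ / 2) ≤ (g : ℝ) ^ (GenDFT.omega / 2 + ε) :=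
    Real.rpow_le_rpow_of_exponent_le hg1 (by linarith)
  have hK0 : 0 ≤ K := by positivity
  refine le_trans ?_ (mul_le_mul_of_nonneg_left h5 hK0)
  rw [h4, ← Finset.mul_sum]
  have h6 := mul_le_mul_of_nonneg_left h1 hb
  have h7 := mul_le_mul_of_nonneg_left h3 (show 0 ≤ b * (4 + 6 * 2 ^ τ) by positivity)
  rw [hK]
  linarith
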